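/- Let $N\ge 1$ and let $\Omega\subset\mathbb R^N$ be a bounded open set (for instance a bounded domain with Lipschitz boundary). Let $K:\mathbb R^N\setminus\{0\}\to(0,\infty)$ satisfy: $\min\{|x|^2,1\}K(x)\in L^1(\mathbb R^N)$; there are $\alpha>0$ and $s\in(0,1)$ with $N>2s$ such that $K(x)\ge\alpha|x|^{-(N+2s)}$ for all $x\ne0$; and $K(-x)=K(x)$ for all $x\neq 0$. Let $X_K(\Omega)$ be the space of all $u\in L^2(\mathbb R^N)$ with $\int_{\mathbb R^{2N}}(u(x)-u(y))^2K(x-y)\,dx\,dy<\infty$ and $u=0$ a.e. in $\mathbb R^N\setminus\Omega$, with the scalar product $$\langle u,v\rangle=\int_{\mathbb R^{2N}}(u(x)-u(y))(v(x)-v(y))K(x-y)\,dx\,dy$$ and norm $\|u\|=\langle u,u\rangle^{1/2}$. For $\rho\in L^\infty(\Omega)\setminus\{0\}$, a function $u\in X_K(\Omega)\setminus\{0\}$ is an eigenfunction (of $L_Ku=\lambda\rho u$ in $\Omega$, $u=0$ in $\mathbb R^N\setminus\Omega$) if for some $\lambda\in\mathbb R$ $$\langle u,v\rangle=\lambda\int_\Omega\rho\,uv\,dx\quad\text{for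 all }v\in X_K(\Omega),$$ and $\rho$ has the unique continuation property if $|\{x\in\Omega:u(x)=0\}|=0$ for every eigenfunction $u$, whatever $\lambda$. For an integer $j\ge1$ let $\mathcal F_j$ be the family of all $j$-dimensional linear subspaces of $X_K(\Omega)$ and define $$\lambda_j(\rho)^{-1}=\sup_{F\in\mathcal F_j}\ \inf_{u\in F,\ \|u\|=1}\int_\Omega\rho u^2\,dx\quad\text{if }\rho^+\not\equiv0,\qquad \lambda_{-j}(\rho)^{-1}=\inf_{F\in\mathcal F_j}\ \sup_{u\in F,\ \|u\|=1}\int_\Omega\rho u^2\,dx\quad\text{if }\rho^-\not\equiv0.$$ A nonzero integer $k$ is admissible for $\rho$ if either $k>0$ and $\rho^+\not\equiv0$, or $k<0$ and $\rho^-\not\equiv0$. Let $\rho,\tilde\rho\in L^\infty(\Omega)\setminus\{0\}$ satisfy $\rho\le\tilde\rho$ a.e. in $\Omega$ and $\rho\not\equiv\tilde\rho$, and suppose that $\rho$ or $\tilde\rho$ has the unique continuation property. Then $\lambda_k(\rho)>\lambda_k(\tilde\rho)$ for every $k\in\mathbb Z\setminus\{0\}$ that is admissible for both $\rho$ and $\tilde\rho$.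 -/

import Mathlib

open MeasureTheory
open scoped ENNReal

namespace NonlocalEigen

/-- The Euclidean space `ℝ^N`. -/
abbrev E (N : ℕ) : Type := EuclideanSpace ℝ (Fin N)

/-- The hypotheses on the kernel `K : ℝ^N ∖ {0} → (0, ∞)`; the value `K 0` is irrelevant. -/
structure IsKernel {N : ℕ} (K : E N → ℝ) : Prop where
  pos : ∀ x : E N, x ≠ 0 → 0 < K x
  integrable : Integrable (fun x : E N => min (‖x‖ ^ 2) 1 * K x) volume
  lower_bound : ∃ α : ℝ, 0 < α ∧ ∃ s : ℝ, 0 < s ∧ s < 1 ∧ 2 * s < (N : ℝ) ∧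
    ∀ x : E N, x ≠ 0 → α * ‖x‖ ^ (-((N : ℝ) + 2 * s)) ≤ K x
  symm : ∀ x : E N, x ≠ 0 → K (-x) = K x

/-- The scalar product
`⟨u, v⟩ = ∫_{ℝ^{2N}} (u(x) - u(y)) (v(x) - v(y)) K(x - y) dx dy`. -/
noncomputable def form {N : ℕ} (K : E N → ℝ) (u v : Lp ℝ 2 (volume : Measure (E N))) : ℝ :=
  ∫ p : E N × E N, (u p.1 - u p.2) * (v p.1 - v p.2) * K (p.1 - p.2)

/-- The space `X_K(Ω)` of all `u ∈ L²(ℝ^N)` with `[u]_K < ∞` and `u = 0` a.e. outside `Ω`. -/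
def X {N : ℕ} (K : E N → ℝ) (Ω : Set (E N)) : Set (Lp ℝ 2 (volume : Measure (E N))) :=
  {u | Integrable (fun p : E N × E N => (u p.1 - u p.2) ^ 2 * K (p.1 - p.2)) volume ∧
    ∀ᵐ x : E N, x ∉ Ω → u x = 0}

/-- `u ∈ X_K(Ω) ∖ {0}` is an eigenfunction, with eigenvalue `lam`, of `L_K u = lam ρ u` in `Ω`,
`u = 0` outside `Ω`, in the weak sense. -/
def IsEigenfunction {N : ℕ} (K : E N → ℝ) (Ω : Set (E N)) (ρ : Lp ℝ ∞ (volume.restrict Ω))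
    (lam : ℝ) (u : Lp ℝ 2 (volume : Measure (E N))) : Prop :=
  u ∈ X K Ω ∧ u ≠ 0 ∧
    ∀ v ∈ X K Ω, form K u v = lam * ∫ x in Ω, ρ x * (u x * v x)

/-- The unique continuation property of the weight `ρ`. -/
def UCP {N : ℕ} (K : E N → ℝ) (Ω : Set (E N)) (ρ : Lp ℝ ∞ (volume.restrict Ω)) : Prop :=
  ∀ (lam : ℝ) (u : Lp ℝ 2 (volume : Measure (E N))), IsEigenfunction K Ω ρ lam u →
    volume {x ∈ Ω | u x = 0} = 0

/-- The family of all `k`-dimensional linear subspaces of `X_K(Ω)` (used for `k ≥ 1`). -/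
def Subspaces {N : ℕ} (K : E N → ℝ) (Ω : Set (E N)) (k : ℕ) :
    Set (Submodule ℝ (Lp ℝ 2 (volume : Measure (E N)))) :=
  {F | (F : Set (Lp ℝ 2 (volume : Measure (E N)))) ⊆ X K Ω ∧ Module.finrank ℝ F = k}

/-- The unit sphere `{u ∈ F : ‖u‖ = 1}` with respect to the norm of `X_K(Ω)`. -/
def sphere {N : ℕ} (K : E N → ℝ) (F : Submodule ℝ (Lp ℝ 2 (volume : Measure (E N)))) :
    Set (Lp ℝ 2 (volume : Measure (E N))) :=
  {u | u ∈ F ∧ form K u u = 1}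

/-- The variational eigenvalue `λ_k(ρ)`, for `k ≠ 0`: with `j = |k|`,
`λ_j(ρ)⁻¹ = sup_{dim F = j} inf_{u ∈ F, ‖u‖ = 1} ∫_Ω ρ u²` and
`λ_{-j}(ρ)⁻¹ = inf_{dim F = j} sup_{u ∈ F, ‖u‖ = 1} ∫_Ω ρ u²`. -/
noncomputable def eigenvalue {N : ℕ} (K : E N → ℝ) (Ω : Set (E N))
    (ρ : Lp ℝ ∞ (volume.restrict Ω)) (k : ℤ) : ℝ :=
  if 0 < k then
    (⨆ F : Subspaces K Ω k.natAbs, ⨅ u : sphere K F.1, ∫ x in Ω, ρ x * u.1 x ^ 2)⁻¹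
  else
    (⨅ F : Subspaces K Ω k.natAbs, ⨆ u : sphere K F.1, ∫ x in Ω, ρ x * u.1 x ^ 2)⁻¹

/-- The index `k ∈ ℤ ∖ {0}` is admissible for `ρ`: positive indices occur when `ρ⁺ ≢ 0`,
negative ones when `ρ⁻ ≢ 0`. -/
def Admissible {N : ℕ} {Ω : Set (E N)} (ρ : Lp ℝ ∞ (volume.restrict Ω)) (k : ℤ) : Prop :=
  (0 < k ∧ ρ⁺ ≠ 0) ∨ (k < 0 ∧ ρ⁻ ≠ 0)

end NonlocalEigen

/-! On the Hilbert space `X_K(Ω)` the form `b_ρ(u, v) = ∫_Ω ρ u v` is symmetric and controlled by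
the `L²` norm, and the embedding into `L²` is compact. Hence `λ_j(ρ)⁻¹` is the `j`-th positive
eigenvalue, from the top, of a compact symmetric form, and `ρ ≤ ρ'` at once gives the weak
inequality.

Strictness (`minimaxValue_lt`) comes from knowing where the minimax is attained. Let `m` and `n` be
the values for `b = b_ρ` and `b' = b_ρ'`, and let `W` be the span of the first `j` eigenvectors of
`b`, so that `b ≥ m‖·‖²` on `W`, with equality only at eigenvectors. If `ρ` has unique continuation,
each unit `u ∈ W` has `b(u, u) > m`, or is an eigenfunction, hence nonzero a.e. in `Ω`, and then
`b'(u, u) > b(u, u)`. So `b' > m` on the compact unit sphere of `W`. If instead `ρ'` has unique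
continuation, some `u ≠ 0` in `W` is orthogonal to the first `j - 1` eigenvectors of `b'`, so `m‖u‖²
≤ b(u, u) ≤ b'(u, u) ≤ n‖u‖²`; equality in the last place makes `u` an eigenfunction for `ρ'`, and
then the middle inequality is strict.

The analytic inputs are `exists_poincare` and `isCompactOperator_incl`, both read off
`norm_sq_le_cells`, and `exists_positive_weight_subspace`, which makes every minimax value positive
so that taking reciprocals reverses the order. Negative indices reduce to positive ones by `ρ ↦ -ρ`.
-/

namespace NonlocalEigen

/-! ### Minimax theory for symmetric forms on a Hilbert space, relative to a compact operator. -/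

section Abstract

open Filter Topology
open scoped InnerProductSpace

variable {H : Type*} [NormedAddCommGroup H] [InnerProductSpace ℝ H]

/-- `u` satisfies the eigenvector relation for the form `b` with Rayleigh quotient `m`. -/
def IsFormEigen (b : H →L[ℝ] H →L[ℝ] ℝ) (m : ℝ) (u : H) : Prop :=
  ∀ v, b u v = m * ⟪u, v⟫_ℝ

/-- The deficit `M‖·‖² - b` is a quadratic form. This identity makes maximizing sequences strongly
Cauchy, with no recourse to weak convergence. -/
theorem rayleigh_parallelogram (b : H →L[ℝ] H →L[ℝ] ℝ) (M : ℝ) (x y : H) :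
    (M * ‖x - y‖ ^ 2 - b (x - y) (x - y)) + (M * ‖x + y‖ ^ 2 - b (x + y) (x + y)) =
      2 * (M * ‖x‖ ^ 2 - b x x) + 2 * (M * ‖y‖ ^ 2 - b y y) := by
  have h := parallelogram_law_with_norm ℝ x y
  simp only [map_add, map_sub, add_apply, sub_apply]
  linear_combination M * h

/-- A form which is compact relative to a compact operator `ι` attains a positive supremum on the
unit sphere of a closed subspace. -/
theorem exists_rayleigh_max [CompleteSpace H] {L : Type*} [NormedAddCommGroup L] [NormedSpace ℝ L]
    (b : H →L[ℝ] H →L[ℝ] ℝ) (ι : H →L[ℝ] L) (hι : IsCompactOperator ι) (C : ℝ) (hC : 0 ≤ C)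
    (hb : ∀ u, b u u ≤ C * ‖ι u‖ ^ 2) (G : Submodule ℝ H) (hG : IsClosed (G : Set H))
    (hpos : ∃ u ∈ G, 0 < b u u) :
    ∃ u ∈ G, ‖u‖ = 1 ∧ 0 < b u u ∧ ∀ v ∈ G, b v v ≤ b u u * ‖v‖ ^ 2 := by
  set s : Set ℝ := {t | ∃ u ∈ G, ‖u‖ = 1 ∧ t = b u u} with hs
  have hbdd : BddAbove s := by
    refine ⟨C * ‖ι‖ ^ 2, ?_⟩
    rintro t ⟨u, -, hu1, rfl⟩
    refine (hb u).trans ?_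
    have : ‖ι u‖ ≤ ‖ι‖ := by simpa [hu1] using ι.le_opNorm u
    gcongr
  have hnorm : ∀ v ∈ G, v ≠ 0 → b v v / ‖v‖ ^ 2 ∈ s := by
    intro v hv hv0
    have hn : ‖v‖ ≠ 0 := norm_ne_zero_iff.2 hv0
    refine ⟨‖v‖⁻¹ • v, G.smul_mem _ hv, ?_, ?_⟩
    · rw [norm_smul, norm_inv, norm_norm, inv_mul_cancel₀ hn]
    · simp only [map_smul, smul_apply, smul_eq_mul]
      field_simp
  obtain ⟨u0, hu0G, hu0⟩ := hpos
  have hu00 : u0 ≠ 0 := by rintro rfl; simp at hu0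
  have hne : s.Nonempty := ⟨_, hnorm u0 hu0G hu00⟩
  set M := sSup s with hM
  have hMpos : 0 < M :=
    lt_of_lt_of_le (div_pos hu0 (pow_pos (norm_pos_iff.2 hu00) 2))
      (le_csSup hbdd (hnorm u0 hu0G hu00))
  have hMle : ∀ v ∈ G, b v v ≤ M * ‖v‖ ^ 2 := by
    intro v hv
    by_cases hv0 : v = 0
    · simp [hv0]
    · have := le_csSup hbdd (hnorm v hv hv0)
      rwa [div_le_iff₀ (pow_pos (norm_pos_iff.2 hv0) 2)] at this
  obtain ⟨t, -, htM, hts⟩ := exists_seq_tendsto_sSup hne hbdd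
  choose u huG hu1 hut using hts
  obtain ⟨S, hS, hSι⟩ := hι.image_subset_compact_of_isVonNBounded
    (NormedSpace.isVonNBounded_closedBall ℝ H 1)
  obtain ⟨y, -, φ, hφ, hy⟩ := hS.tendsto_subseq (x := fun n => ι (u n))
    (fun n => hSι ⟨u n, by simp [hu1 n], rfl⟩)
  have hcι : CauchySeq (fun n => ι (u (φ n))) := hy.cauchySeq
  have hcM : Tendsto (fun n => M * ‖u (φ n)‖ ^ 2 - b (u (φ n)) (u (φ n))) atTop (𝓝 0) := by
    have h1 : Tendsto (fun n => M - t (φ n)) atTop (𝓝 (M - M)) :=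
      tendsto_const_nhds.sub (htM.comp hφ.tendsto_atTop)
    rw [sub_self] at h1
    refine h1.congr fun n => ?_
    rw [hu1, hut]; ring
  -- The deficit of the sum is nonnegative on `G` and those of the two terms tend to `0`, so `M‖x -
  -- y‖²` is at most `b(x - y, x - y)`, hence `C‖ι(x - y)‖²`, plus a small error. The bounds add up
  -- to `Mε²/2 + Mε²/4`; `C + 1` avoids dividing by zero.
  have hcau : CauchySeq (fun n => u (φ n)) := by
    rw [Metric.cauchySeq_iff]
    intro ε hε
    have hη : 0 < M * ε ^ 2 / 8 := by positivity
    have hη' : 0 < Real.sqrt (M * ε ^ 2 / (4 * (C + 1))) := by positivity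
    obtain ⟨N1, hN1⟩ := (Metric.tendsto_atTop.1 hcM) _ hη
    obtain ⟨N2, hN2⟩ := (Metric.cauchySeq_iff.1 hcι) _ hη'
    refine ⟨max N1 N2, fun m hm n hn => ?_⟩
    have e1 := hN1 m (le_of_max_le_left hm)
    have e2 := hN1 n (le_of_max_le_left hn)
    have e3 := hN2 m (le_of_max_le_right hm) n (le_of_max_le_right hn)
    rw [Real.dist_eq, sub_zero] at e1 e2
    rw [dist_eq_norm, ← map_sub] at e3
    rw [dist_eq_norm]
    have e1' := (le_abs_self _).trans_lt e1
    have e2' := (le_abs_self _).trans_lt e2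
    have e4 := rayleigh_parallelogram b M (u (φ m)) (u (φ n))
    have e5 := hMle _ (G.add_mem (huG (φ m)) (huG (φ n)))
    have e6 := hb (u (φ m) - u (φ n))
    have e7 : ‖ι (u (φ m) - u (φ n))‖ ^ 2 ≤ M * ε ^ 2 / (4 * (C + 1)) := by
      rw [← Real.sq_sqrt (show 0 ≤ M * ε ^ 2 / (4 * (C + 1)) by positivity)]
      gcongr
    have e8 : C * ‖ι (u (φ m) - u (φ n))‖ ^ 2 ≤ M * ε ^ 2 / 4 := by
      calc C * ‖ι (u (φ m) - u (φ n))‖ ^ 2 ≤ (C + 1) * (M * ε ^ 2 / (4 * (C + 1))) := by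
            gcongr; linarith
        _ = M * ε ^ 2 / 4 := by field_simp
    have e9 : M * ‖u (φ m) - u (φ n)‖ ^ 2 < M * ε ^ 2 := by
      have : 0 < M * ε ^ 2 := by positivity
      linarith
    have e10 := lt_of_mul_lt_mul_left e9 hMpos.le
    exact lt_of_pow_lt_pow_left₀ 2 hε.le e10
  obtain ⟨x, hx⟩ := cauchySeq_tendsto_of_complete hcau
  have hxG : x ∈ G := hG.mem_of_tendsto hx (Eventually.of_forall fun n => huG _)
  have hx1 : ‖x‖ = 1 := by
    refine tendsto_nhds_unique hx.norm ?_
    simp [hu1]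
  have hbx : b x x = M := by
    have h1 : Tendsto (fun n => b (u (φ n)) (u (φ n))) atTop (𝓝 (b x x)) := by
      have : Continuous fun z => b z z := by fun_prop
      exact (this.tendsto x).comp hx
    refine tendsto_nhds_unique h1 ?_
    refine (htM.comp hφ.tendsto_atTop).congr fun n => ?_
    simp [hut]
  exact ⟨x, hxG, hx1, hbx ▸ hMpos, fun v hv => hbx ▸ hMle v hv⟩

/-- If the form `m ‖·‖² - b` is nonnegative on `G` and vanishes at `u ∈ G`, then `u` satisfies the
eigenvector relation against `G`. -/
theorem eigen_of_rayleigh_eq (b : H →L[ℝ] H →L[ℝ] ℝ) (hsymm : ∀ u v, b u v = b v u) (m : ℝ)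
    (G : Submodule ℝ H) (hG : ∀ v ∈ G, b v v ≤ m * ‖v‖ ^ 2) {u : H} (hu : u ∈ G)
    (hum : b u u = m * ‖u‖ ^ 2) {v : H} (hv : v ∈ G) : b u v = m * ⟪u, v⟫_ℝ := by
  -- A quadratic in `t` that is nonnegative and has no constant term has no linear term either.
  have key : ∀ t : ℝ, 0 ≤ (m * ‖v‖ ^ 2 - b v v) * (t * t) + 2 * (m * ⟪u, v⟫_ℝ - b u v) * t + 0 := by
    intro t
    have h := hG _ (G.add_mem hu (G.smul_mem t hv))
    have h2 : ‖u + t • v‖ ^ 2 = ‖u‖ ^ 2 + 2 * (t * ⟪u, v⟫_ℝ) + t ^ 2 * ‖v‖ ^ 2 := by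
      rw [norm_add_sq_real, inner_smul_right, norm_smul, mul_pow, Real.norm_eq_abs, sq_abs]
    rw [h2] at h
    simp only [map_add, map_smul, add_apply, smul_apply,
      smul_eq_mul] at h
    rw [hsymm v u, hum] at h
    linarith
  have hd := discrim_le_zero key
  rw [discrim] at hd
  have : (m * ⟪u, v⟫_ℝ - b u v) ^ 2 ≤ 0 := by linarith
  have := pow_eq_zero_iff (two_ne_zero) |>.1 (le_antisymm this (sq_nonneg _))
  linarith

/-- A nontrivial intersection of a subspace with the orthogonal complement of a smaller one. -/
theorem exists_mem_inf_orthogonal (F W : Submodule ℝ H) [FiniteDimensional ℝ W]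
    (h : Module.finrank ℝ W < Module.finrank ℝ F) : ∃ u ∈ F, u ∈ Wᗮ ∧ u ≠ 0 := by
  have : FiniteDimensional ℝ F := Module.finite_of_finrank_pos (by omega)
  let f : F →ₗ[ℝ] W := (W.orthogonalProjectionOnto : H →ₗ[ℝ] W) ∘ₗ F.subtype
  have hk : LinearMap.ker f ≠ ⊥ := LinearMap.ker_ne_bot_of_finrank_lt h
  obtain ⟨x, hx, hx0⟩ := Submodule.exists_mem_ne_zero_of_ne_bot hk
  refine ⟨x, x.2, ?_, by simpa using hx0⟩
  have : W.orthogonalProjectionOnto (x : H) = 0 := hx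
  exact Submodule.orthogonalProjectionOnto_eq_zero_iff.1 this

/-- Induction on `j`: a maximizer of `b` on the unit sphere of `Wᗮ` is adjoined to `W`. Since `b`
does not couple `W` and `Wᗮ`, such a maximizer is an eigenvector against the whole space. The
equality clauses are what strict monotonicity needs later; `W'` is the subspace before the last
step. The hypothesis `hpos` keeps each new maximum positive. -/
theorem exists_spectral_subspace [CompleteSpace H] {L : Type*} [NormedAddCommGroup L]
    [NormedSpace ℝ L] (b : H →L[ℝ] H →L[ℝ] ℝ) (hsymm : ∀ u v, b u v = b v u) (ι : H →L[ℝ] L)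
    (hι : IsCompactOperator ι) (C : ℝ) (hC : 0 ≤ C) (hb : ∀ u, b u u ≤ C * ‖ι u‖ ^ 2) (j : ℕ)
    (hpos : ∃ F : Submodule ℝ H, j ≤ Module.finrank ℝ F ∧ ∀ u ∈ F, u ≠ 0 → 0 < b u u) :
    ∃ (W : Submodule ℝ H) (m : ℝ), FiniteDimensional ℝ W ∧ Module.finrank ℝ W = j ∧ 0 < m ∧
      (∀ w ∈ W, ∀ v ∈ Wᗮ, b w v = 0) ∧ (∀ u ∈ W, m * ‖u‖ ^ 2 ≤ b u u) ∧
      (∀ u ∈ W, b u u = m * ‖u‖ ^ 2 → IsFormEigen b m u) ∧ (∀ u ∈ Wᗮ, b u u ≤ m * ‖u‖ ^ 2) ∧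
      (0 < j → ∃ W' : Submodule ℝ H, FiniteDimensional ℝ W' ∧ Module.finrank ℝ W' < j ∧
        (∀ u ∈ W'ᗮ, b u u ≤ m * ‖u‖ ^ 2) ∧
        ∀ u ∈ W'ᗮ, b u u = m * ‖u‖ ^ 2 → IsFormEigen b m u) := by
  induction j with
  | zero =>
    -- With `W = ⊥` any positive upper bound for the Rayleigh quotient serves as `m`.
    refine ⟨⊥, C * ‖ι‖ ^ 2 + 1, inferInstance, by simp, by positivity, ?_, ?_, ?_, ?_, by simp⟩
    · intro w hw v _
      rw [(Submodule.mem_bot ℝ).1 hw]; simp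
    · intro w hw
      rw [(Submodule.mem_bot ℝ).1 hw]; simp
    · intro w hw _ v
      rw [(Submodule.mem_bot ℝ).1 hw]; simp
    · intro u _
      have h1 : ‖ι u‖ ^ 2 ≤ (‖ι‖ * ‖u‖) ^ 2 := by gcongr; exact ι.le_opNorm u
      calc b u u ≤ C * ‖ι u‖ ^ 2 := hb u
        _ ≤ C * (‖ι‖ * ‖u‖) ^ 2 := by gcongr
        _ ≤ (C * ‖ι‖ ^ 2 + 1) * ‖u‖ ^ 2 := by nlinarith [sq_nonneg ‖u‖]
  | succ j ih =>
    obtain ⟨F, hF, hFpos⟩ := hpos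
    obtain ⟨W, m, hWfin, hWdim, hm, hinv, hlow, hloweq, hup, -⟩ := ih ⟨F, by omega, hFpos⟩
    obtain ⟨x, hxF, hxW, hx0⟩ := exists_mem_inf_orthogonal F W (by omega)
    obtain ⟨u, huW, hu1, hupos, humax⟩ := exists_rayleigh_max b ι hι C hC hb Wᗮ
      (Submodule.isClosed_orthogonal W) ⟨x, hxW, hFpos x hxF hx0⟩
    set m' := b u u with hm'
    have hm'm : m' ≤ m := by simpa [hu1] using hup u huW
    -- The test vector splits along `W ⊕ Wᗮ`: on `W` both sides vanish, on `Wᗮ` maximality gives the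
    -- relation.
    have heig : ∀ v ∈ Wᗮ, b v v = m' * ‖v‖ ^ 2 → IsFormEigen b m' v := by
      intro v hv hveq z
      obtain ⟨w, hw, w', hw', rfl⟩ := W.exists_add_mem_mem_orthogonal z
      rw [map_add, inner_add_right, eigen_of_rayleigh_eq b hsymm m' Wᗮ humax hv hveq hw',
        hsymm v w, hinv w hw v hv, Submodule.inner_left_of_mem_orthogonal hw hv]
      ring
    have hueig : IsFormEigen b m' u := heig u huW (by simp [hu1, hm'])
    have hdecomp : ∀ z ∈ W ⊔ ℝ ∙ u, ∃ w ∈ W, ∃ t : ℝ, z = w + t • u := by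
      intro z hz
      obtain ⟨w, hw, y, hy, rfl⟩ := Submodule.mem_sup.1 hz
      obtain ⟨t, rfl⟩ := Submodule.mem_span_singleton.1 hy
      exact ⟨w, hw, t, rfl⟩
    have hbexp : ∀ w ∈ W, ∀ t : ℝ, b (w + t • u) (w + t • u) = b w w + t ^ 2 * m' := by
      intro w hw t
      simp only [map_add, map_smul, add_apply, smul_apply,
        smul_eq_mul]
      rw [hsymm u w, hinv w hw u huW, ← hm']
      ring
    have hnexp : ∀ w ∈ W, ∀ t : ℝ, ‖w + t • u‖ ^ 2 = ‖w‖ ^ 2 + t ^ 2 := by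
      intro w hw t
      rw [norm_add_sq_real, inner_smul_right, Submodule.inner_right_of_mem_orthogonal hw huW,
        norm_smul, mul_pow, hu1, Real.norm_eq_abs, sq_abs]
      ring
    have hu0 : u ≠ 0 := by rintro rfl; simp at hu1
    refine ⟨W ⊔ ℝ ∙ u, m', inferInstance, ?_, hupos, ?_, ?_, ?_, ?_, fun _ =>
      ⟨W, hWfin, by omega, humax, heig⟩⟩
    · have hdisj : W ⊓ (ℝ ∙ u) = ⊥ := by
        rw [Submodule.eq_bot_iff]
        rintro z ⟨hzW, hzu⟩
        have hz' : z ∈ Wᗮ := (Submodule.span_singleton_le_iff_mem _ _).2 huW hzu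
        have : z ∈ W ⊓ Wᗮ := ⟨hzW, hz'⟩
        rwa [Submodule.inf_orthogonal_eq_bot] at this
      have h := Submodule.finrank_sup_add_finrank_inf_eq W (ℝ ∙ u)
      rw [hdisj, finrank_bot, finrank_span_singleton hu0] at h
      omega
    · intro z hz v hv
      obtain ⟨w, hw, t, rfl⟩ := hdecomp z hz
      have hvW : v ∈ Wᗮ := Submodule.orthogonal_le le_sup_left hv
      have hvu : ⟪u, v⟫_ℝ = 0 := Submodule.inner_right_of_mem_orthogonal
        (Submodule.mem_sup_right (Submodule.mem_span_singleton_self u)) hv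
      simp only [map_add, map_smul, add_apply, smul_apply,
        smul_eq_mul]
      rw [hinv w hw v hvW, hueig v, hvu]; ring
    · intro z hz
      obtain ⟨w, hw, t, rfl⟩ := hdecomp z hz
      rw [hbexp w hw, hnexp w hw]
      nlinarith [hlow w hw, mul_le_mul_of_nonneg_right hm'm (sq_nonneg ‖w‖)]
    · intro z hz heq
      obtain ⟨w, hw, t, rfl⟩ := hdecomp z hz
      rw [hbexp w hw, hnexp w hw] at heq
      have hwm : b w w = m' * ‖w‖ ^ 2 := by linarith
      have hweig : IsFormEigen b m' w := by
        -- If the value dropped strictly, the part in `W` must be zero, because its quotient is at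
        -- least `m > m'`; if not, the inductive equality clause applies.
        rcases hm'm.lt_or_eq with hlt | heq'
        · have h1 := hlow w hw
          rw [hwm] at h1
          have h2 : ‖w‖ ^ 2 = 0 := by
            by_contra h
            have : 0 < ‖w‖ ^ 2 := lt_of_le_of_ne (sq_nonneg _) (Ne.symm h)
            nlinarith
          have h3 : w = 0 := by simpa using h2
          intro v; simp [h3]
        · rw [heq']; exact hloweq w hw (heq' ▸ hwm)
      intro v
      simp only [map_add, map_smul, add_apply, smul_apply,
        smul_eq_mul, inner_add_left, inner_smul_left]
      rw [hweig v, hueig v]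
      simp; ring
    · intro v hv
      exact humax v (Submodule.orthogonal_le le_sup_left hv)

/-- The minimax value `sup_{dim F = j} inf_{u ∈ F, ‖u‖ = 1} b(u, u)`. -/
noncomputable def minimaxValue (b : H →L[ℝ] H →L[ℝ] ℝ) (j : ℕ) : ℝ :=
  ⨆ F : {F : Submodule ℝ H // Module.finrank ℝ F = j}, ⨅ u : {u : H // u ∈ F.1 ∧ ‖u‖ = 1}, b u.1 u.1

theorem abs_form_le_of_norm_eq_one (b : H →L[ℝ] H →L[ℝ] ℝ) {u : H} (hu : ‖u‖ = 1) :
    |b u u| ≤ ‖b‖ := by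
  simpa [hu] using b.le_opNorm₂ u u

theorem bddBelow_sphere_form (b : H →L[ℝ] H →L[ℝ] ℝ) (F : Submodule ℝ H) :
    BddBelow (Set.range fun u : {u : H // u ∈ F ∧ ‖u‖ = 1} => b u.1 u.1) := by
  refine ⟨-‖b‖, ?_⟩
  rintro _ ⟨u, rfl⟩
  exact neg_le_of_abs_le (abs_form_le_of_norm_eq_one b u.2.2)

theorem exists_norm_eq_one_of_finrank_pos (F : Submodule ℝ H) (h : 0 < Module.finrank ℝ F) :
    ∃ u ∈ F, ‖u‖ = 1 := by
  have hF : F ≠ ⊥ := by rintro rfl; simp at h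
  obtain ⟨x, hx, hx0⟩ := Submodule.exists_mem_ne_zero_of_ne_bot hF
  exact ⟨‖x‖⁻¹ • x, F.smul_mem _ hx, by
    rw [norm_smul, norm_inv, norm_norm, inv_mul_cancel₀ (norm_ne_zero_iff.2 hx0)]⟩

/-- A real-valued `⨆` is only meaningful for a bounded family: since `0 < j`, every unit sphere is
nonempty and each infimum is at most `‖b‖`. -/
theorem le_minimaxValue (b : H →L[ℝ] H →L[ℝ] ℝ) {j : ℕ} (hj : 0 < j) (F : Submodule ℝ H)
    (hF : Module.finrank ℝ F = j) :
    ⨅ u : {u : H // u ∈ F ∧ ‖u‖ = 1}, b u.1 u.1 ≤ minimaxValue b j := by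
  refine le_ciSup (f := fun F : {F : Submodule ℝ H // Module.finrank ℝ F = j} =>
    ⨅ u : {u : H // u ∈ F.1 ∧ ‖u‖ = 1}, b u.1 u.1) ⟨‖b‖, ?_⟩ ⟨F, hF⟩
  rintro _ ⟨⟨G, hG⟩, rfl⟩
  obtain ⟨u, hu, hu1⟩ := exists_norm_eq_one_of_finrank_pos G (by omega)
  exact (ciInf_le (bddBelow_sphere_form b G) ⟨u, hu, hu1⟩).trans
    (le_of_abs_le (abs_form_le_of_norm_eq_one b hu1))

/-- Courant–Fischer: `W` is a competitor with infimum at least `m`, and every `j`-dimensional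
subspace meets `W'ᗮ` nontrivially, where `b` is at most `m‖·‖²`. -/
theorem minimaxValue_eq (b : H →L[ℝ] H →L[ℝ] ℝ) {j : ℕ} (hj : 0 < j) {m : ℝ}
    (W : Submodule ℝ H) (hW : Module.finrank ℝ W = j) (hlow : ∀ u ∈ W, m * ‖u‖ ^ 2 ≤ b u u)
    (W' : Submodule ℝ H) [FiniteDimensional ℝ W'] (hW' : Module.finrank ℝ W' < j)
    (hup : ∀ u ∈ W'ᗮ, b u u ≤ m * ‖u‖ ^ 2) : minimaxValue b j = m := by
  apply le_antisymm
  · have : Nonempty {F : Submodule ℝ H // Module.finrank ℝ F = j} := ⟨⟨W, hW⟩⟩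
    refine ciSup_le fun F => ?_
    obtain ⟨u, huF, huW, hu0⟩ := exists_mem_inf_orthogonal F.1 W' (by rw [F.2]; exact hW')
    have hu1 : ‖‖u‖⁻¹ • u‖ = 1 := by
      rw [norm_smul, norm_inv, norm_norm, inv_mul_cancel₀ (norm_ne_zero_iff.2 hu0)]
    refine (ciInf_le (bddBelow_sphere_form b F.1) ⟨_, F.1.smul_mem _ huF, hu1⟩).trans ?_
    simpa only [hu1, one_pow, mul_one] using hup _ (W'ᗮ.smul_mem ‖u‖⁻¹ huW)
  · refine le_trans ?_ (le_minimaxValue b hj W hW)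
    obtain ⟨u, hu, hu1⟩ := exists_norm_eq_one_of_finrank_pos W (by omega)
    have : Nonempty {u : H // u ∈ W ∧ ‖u‖ = 1} := ⟨⟨u, hu, hu1⟩⟩
    refine le_ciInf fun v => ?_
    simpa [v.2.2] using hlow v.1 v.2.1

theorem minimaxValue_pos [CompleteSpace H] {L : Type*} [NormedAddCommGroup L]
    [NormedSpace ℝ L] (b : H →L[ℝ] H →L[ℝ] ℝ) (hsymm : ∀ u v, b u v = b v u) (ι : H →L[ℝ] L)
    (hι : IsCompactOperator ι) (C : ℝ) (hC : 0 ≤ C) (hb : ∀ u, b u u ≤ C * ‖ι u‖ ^ 2) {j : ℕ}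
    (hj : 0 < j)
    (hpos : ∃ F : Submodule ℝ H, j ≤ Module.finrank ℝ F ∧ ∀ u ∈ F, u ≠ 0 → 0 < b u u) :
    0 < minimaxValue b j := by
  obtain ⟨W, m, hWfin, hWdim, hm, -, hlow, -, -, h⟩ :=
    exists_spectral_subspace b hsymm ι hι C hC hb j hpos
  obtain ⟨W', hW'fin, hW'dim, hup, -⟩ := h hj
  rwa [minimaxValue_eq b hj W hWdim hlow W' hW'dim hup]

/-- Strict monotonicity of the minimax values under a unique continuation hypothesis. -/
theorem minimaxValue_lt [CompleteSpace H] {L : Type*} [NormedAddCommGroup L]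
    [NormedSpace ℝ L] (b b' : H →L[ℝ] H →L[ℝ] ℝ) (hsymm : ∀ u v, b u v = b v u)
    (hsymm' : ∀ u v, b' u v = b' v u) (ι : H →L[ℝ] L)
    (hι : IsCompactOperator ι) (C : ℝ) (hC : 0 ≤ C) (hb : ∀ u, b u u ≤ C * ‖ι u‖ ^ 2)
    (hb' : ∀ u, b' u u ≤ C * ‖ι u‖ ^ 2) {j : ℕ} (hj : 0 < j)
    (hpos : ∃ F : Submodule ℝ H, j ≤ Module.finrank ℝ F ∧ ∀ u ∈ F, u ≠ 0 → 0 < b u u)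
    (hle : ∀ u, b u u ≤ b' u u)
    (hucp : (∀ m u, 0 < m → u ≠ 0 → IsFormEigen b m u → b u u < b' u u) ∨
      (∀ m u, 0 < m → u ≠ 0 → IsFormEigen b' m u → b u u < b' u u)) :
    minimaxValue b j < minimaxValue b' j := by
  have hpos' : ∃ F : Submodule ℝ H, j ≤ Module.finrank ℝ F ∧ ∀ u ∈ F, u ≠ 0 → 0 < b' u u := by
    obtain ⟨F, hF, h⟩ := hpos
    exact ⟨F, hF, fun u hu hu0 => (h u hu hu0).trans_le (hle u)⟩
  obtain ⟨W, m, hWfin, hWdim, hm, -, hlow, hloweq, -, h⟩ :=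
    exists_spectral_subspace b hsymm ι hι C hC hb j hpos
  obtain ⟨W', hW'fin, hW'dim, hup, -⟩ := h hj
  rw [minimaxValue_eq b hj W hWdim hlow W' hW'dim hup]
  rcases hucp with hucp | hucp
  -- Unique continuation for `b`: `W` is used as a competitor for `b'`. Compactness of its unit
  -- sphere turns the pointwise strict inequality into a strict one for the infimum.
  · refine lt_of_lt_of_le ?_ (le_minimaxValue b' hj W hWdim)
    have hlt : ∀ u ∈ W, ‖u‖ = 1 → m < b' u u := by
      intro u hu hu1
      have hu0 : u ≠ 0 := by rintro rfl; simp at hu1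
      have h1 := hlow u hu
      rw [hu1, one_pow, mul_one] at h1
      rcases h1.lt_or_eq with h2 | h2
      · exact h2.trans_le (hle u)
      · rw [h2]
        exact hucp m u hm hu0 (hloweq u hu (by rw [hu1, ← h2]; ring))
    obtain ⟨u0, hu0, hu01⟩ := exists_norm_eq_one_of_finrank_pos W (by omega)
    have : ProperSpace W := FiniteDimensional.proper_real W
    obtain ⟨x, hx, hxmin⟩ := (isCompact_sphere (0 : W) 1).exists_isMinOn
      ⟨⟨u0, hu0⟩, by simpa using hu01⟩
      (f := fun w : W => b' (w : H) (w : H)) (by fun_prop)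
    refine (hlt x x.2 (by simpa using hx)).trans_le ?_
    have : Nonempty {u : H // u ∈ W ∧ ‖u‖ = 1} := ⟨⟨u0, hu0, hu01⟩⟩
    refine le_ciInf fun v => ?_
    exact hxmin (show (⟨v.1, v.2.1⟩ : W) ∈ Metric.sphere (0 : W) 1 by simpa using v.2.2)
  -- Unique continuation for `b'`: since `dim V' < j = dim W`, one vector of `W ∩ V'ᗮ` compares the
  -- two values.
  · obtain ⟨V, n, hVfin, hVdim, hn, -, hlowV, -, -, h⟩ :=
      exists_spectral_subspace b' hsymm' ι hι C hC hb' j hpos'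
    obtain ⟨V', hV'fin, hV'dim, hupV, hupeq⟩ := h hj
    rw [minimaxValue_eq b' hj V hVdim hlowV V' hV'dim hupV]
    obtain ⟨u, huW, huV, hu0⟩ := exists_mem_inf_orthogonal W V' (by omega)
    have hupos : 0 < ‖u‖ ^ 2 := pow_pos (norm_pos_iff.2 hu0) 2
    have h1 := hlow u huW
    have h2 := hupV u huV
    have h3 : m * ‖u‖ ^ 2 < n * ‖u‖ ^ 2 := by
      rcases h2.lt_or_eq with h4 | h4
      · exact (h1.trans (hle u)).trans_lt h4
      · exact (h1.trans_lt (hucp n u hn hu0 (hupeq u huV h4))).trans_le h2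
    exact lt_of_mul_lt_mul_right h3 hupos.le

end Abstract

/-! ### The kernel, weighted differences, and the linear structure of `X_K(Ω)`. -/

variable {N : ℕ} {K : E N → ℝ} {Ω : Set (E N)}

theorem IsKernel.dim_pos (hK : IsKernel K) : 0 < N := by
  obtain ⟨_, -, s, hs, -, h, -⟩ := hK.lower_bound
  have : (0 : ℝ) < N := by linarith
  exact_mod_cast this

theorem IsKernel.ae_ne_zero (hK : IsKernel K) : ∀ᵐ x : E N, x ≠ 0 := by
  have : Nontrivial (E N) := Module.nontrivial_of_finrank_pos (R := ℝ) (by simpa using hK.dim_pos)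
  exact (measure_eq_zero_iff_ae_notMem).1 (measure_singleton (0 : E N))

/-- Measurability of `K` is recovered from integrability of `min(|x|², 1) K` by dividing by the
weight, which is nonzero off the null set `{0}`. -/
theorem IsKernel.aestronglyMeasurable (hK : IsKernel K) :
    AEStronglyMeasurable K (volume : Measure (E N)) := by
  have h1 : AEStronglyMeasurable (fun x : E N => (min (‖x‖ ^ 2) 1)⁻¹ * (min (‖x‖ ^ 2) 1 * K x))
      volume := by
    refine AEStronglyMeasurable.mul (Measurable.aestronglyMeasurable ?_)
      hK.integrable.aestronglyMeasurable
    fun_prop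
  refine h1.congr ?_
  filter_upwards [hK.ae_ne_zero] with x hx
  have : min (‖x‖ ^ 2) 1 ≠ 0 := by
    have := norm_pos_iff.2 hx
    positivity
  field_simp

theorem quasiMeasurePreserving_difference :
    Measure.QuasiMeasurePreserving (fun p : E N × E N => p.1 - p.2) volume volume :=
  quasiMeasurePreserving_sub volume volume

theorem quasiMeasurePreserving_fst_volume :
    Measure.QuasiMeasurePreserving (Prod.fst : E N × E N → E N) volume volume :=
  Measure.quasiMeasurePreserving_fst

theorem quasiMeasurePreserving_snd_volume :
    Measure.QuasiMeasurePreserving (Prod.snd : E N × E N → E N) volume volume :=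
  Measure.quasiMeasurePreserving_snd

theorem IsKernel.aestronglyMeasurable_difference (hK : IsKernel K) :
    AEStronglyMeasurable (fun p : E N × E N => K (p.1 - p.2)) volume :=
  hK.aestronglyMeasurable.comp_quasiMeasurePreserving quasiMeasurePreserving_difference

theorem IsKernel.ae_difference_nonneg (hK : IsKernel K) :
    ∀ᵐ p : E N × E N, 0 ≤ K (p.1 - p.2) := by
  have h : ∀ᵐ x : E N, 0 ≤ K x := by
    filter_upwards [hK.ae_ne_zero] with x hx using (hK.pos x hx).le
  exact quasiMeasurePreserving_difference.ae h

/-- The weighted difference `(u(x) - u(y)) K(x - y)^{1/2}`. -/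
noncomputable def wdiff (K : E N → ℝ) (u : E N → ℝ) (p : E N × E N) : ℝ :=
  (u p.1 - u p.2) * Real.sqrt (K (p.1 - p.2))

theorem wdiff_congr_ae {u v : E N → ℝ} (h : u =ᵐ[volume] v) : wdiff K u =ᵐ[volume] wdiff K v := by
  filter_upwards [quasiMeasurePreserving_fst_volume.ae h, quasiMeasurePreserving_snd_volume.ae h]
    with p h1 h2
  simp only [wdiff]
  rw [h1, h2]

theorem IsKernel.aestronglyMeasurable_wdiff (hK : IsKernel K) {u : E N → ℝ}
    (hu : AEStronglyMeasurable u volume) : AEStronglyMeasurable (wdiff K u) volume :=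
  ((hu.comp_quasiMeasurePreserving quasiMeasurePreserving_fst_volume).sub
    (hu.comp_quasiMeasurePreserving quasiMeasurePreserving_snd_volume)).mul
    (Real.continuous_sqrt.comp_aestronglyMeasurable hK.aestronglyMeasurable_difference)

theorem IsKernel.wdiff_mul (hK : IsKernel K) (u v : E N → ℝ) :
    (fun p => wdiff K u p * wdiff K v p) =ᵐ[volume]
      fun p => (u p.1 - u p.2) * (v p.1 - v p.2) * K (p.1 - p.2) := by
  filter_upwards [hK.ae_difference_nonneg] with p hp
  simp only [wdiff]
  rw [mul_mul_mul_comm, Real.mul_self_sqrt hp]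

theorem IsKernel.memLp_wdiff_iff (hK : IsKernel K) {u : E N → ℝ}
    (hu : AEStronglyMeasurable u volume) : MemLp (wdiff K u) 2 volume ↔
      Integrable (fun p : E N × E N => (u p.1 - u p.2) ^ 2 * K (p.1 - p.2)) volume := by
  rw [memLp_two_iff_integrable_sq (hK.aestronglyMeasurable_wdiff hu)]
  refine integrable_congr ?_
  filter_upwards [hK.wdiff_mul u u] with p hp
  rw [sq, hp, sq]

/-- `X_K(Ω)` as a linear subspace of `L²`. -/
def XSubmodule (hK : IsKernel K) (Ω : Set (E N)) :
    Submodule ℝ (Lp ℝ 2 (volume : Measure (E N))) where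
  carrier := X K Ω
  zero_mem' := by
    have h0 : ((0 : Lp ℝ 2 (volume : Measure (E N))) : E N → ℝ) =ᵐ[volume] 0 :=
      Lp.coeFn_zero ℝ 2 volume
    refine ⟨?_, ?_⟩
    · rw [← hK.memLp_wdiff_iff (Lp.aestronglyMeasurable _)]
      refine (MemLp.zero (ε := ℝ)).ae_eq (f := (0 : E N × E N → ℝ)) ?_
      refine Filter.EventuallyEq.trans ?_ (wdiff_congr_ae h0).symm
      refine Filter.Eventually.of_forall fun p => ?_
      simp [wdiff]
    · filter_upwards [h0] with x hx _ using hx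
  add_mem' := by
    rintro u v ⟨hu, hu'⟩ ⟨hv, hv'⟩
    have h0 := Lp.coeFn_add u v
    refine ⟨?_, ?_⟩
    · rw [← hK.memLp_wdiff_iff (Lp.aestronglyMeasurable _)] at hu hv ⊢
      refine (hu.add hv).ae_eq ?_
      refine Filter.EventuallyEq.trans ?_ (wdiff_congr_ae h0).symm
      refine Filter.Eventually.of_forall fun p => ?_
      simp [wdiff]; ring
    · filter_upwards [h0, hu', hv'] with x hx h1 h2 h3
      rw [hx, Pi.add_apply, h1 h3, h2 h3, add_zero]
  smul_mem' := by
    rintro c u ⟨hu, hu'⟩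
    have h0 := Lp.coeFn_smul c u
    refine ⟨?_, ?_⟩
    · rw [← hK.memLp_wdiff_iff (Lp.aestronglyMeasurable _)] at hu ⊢
      refine (hu.const_smul c).ae_eq ?_
      refine Filter.EventuallyEq.trans ?_ (wdiff_congr_ae h0).symm
      refine Filter.Eventually.of_forall fun p => ?_
      simp [wdiff]; ring
    · filter_upwards [h0, hu'] with x hx h1 h3
      rw [hx, Pi.smul_apply, h1 h3, smul_zero]

theorem memLp_wdiff (hK : IsKernel K) {u : Lp ℝ 2 (volume : Measure (E N))} (hu : u ∈ X K Ω) :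
    MemLp (wdiff K u) 2 volume :=
  (hK.memLp_wdiff_iff (Lp.aestronglyMeasurable _)).2 hu.1

/-- The weighted difference as a linear map into `L²(ℝ^{2N})`. -/
noncomputable def wdiffLp (hK : IsKernel K) (Ω : Set (E N)) :
    XSubmodule hK Ω →ₗ[ℝ] Lp ℝ 2 (volume : Measure (E N × E N)) where
  toFun u := (memLp_wdiff hK u.2).toLp _
  map_add' u v := by
    rw [← MemLp.toLp_add]
    refine MemLp.toLp_congr _ _ ((wdiff_congr_ae (Lp.coeFn_add u.1 v.1)).trans ?_)
    refine Filter.Eventually.of_forall fun p => ?_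
    simp [wdiff]; ring
  map_smul' c u := by
    rw [← MemLp.toLp_const_smul]
    refine MemLp.toLp_congr _ _ ((wdiff_congr_ae (Lp.coeFn_smul c u.1)).trans ?_)
    refine Filter.Eventually.of_forall fun p => ?_
    simp [wdiff]; ring

theorem coeFn_wdiffLp (hK : IsKernel K) (u : XSubmodule hK Ω) :
    wdiffLp hK Ω u =ᵐ[volume] wdiff K u.1 :=
  MemLp.coeFn_toLp (memLp_wdiff hK u.2)

theorem inner_wdiffLp (hK : IsKernel K) (u v : XSubmodule hK Ω) :
    inner ℝ (wdiffLp hK Ω u) (wdiffLp hK Ω v) = form K u.1 v.1 := by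
  rw [L2.inner_def, form]
  refine integral_congr_ae ?_
  filter_upwards [coeFn_wdiffLp hK u, coeFn_wdiffLp hK v, hK.wdiff_mul u.1 v.1] with p h1 h2 h3
  rw [h1, h2, ← h3]
  simp [mul_comm]

/-! ### Cell estimates and the Poincaré inequality. -/

theorem form_self (K : E N → ℝ) (u : Lp ℝ 2 (volume : Measure (E N))) :
    form K u u = ∫ p : E N × E N, (u p.1 - u p.2) ^ 2 * K (p.1 - p.2) := by
  simp only [form, sq]

/-- The variance identity: the square is expanded and Fubini applied. On a cell it splits the `L²`
mass into an oscillation and a mean. -/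
theorem integral_sq_difference {α : Type*} [MeasurableSpace α] (μ : Measure α) [IsFiniteMeasure μ]
    {w : α → ℝ} (hw : MemLp w 2 μ) :
    Integrable (fun p : α × α => (w p.1 - w p.2) ^ 2) (μ.prod μ) ∧
    ∫ p : α × α, (w p.1 - w p.2) ^ 2 ∂μ.prod μ =
      2 * μ.real Set.univ * ∫ x, w x ^ 2 ∂μ - 2 * (∫ x, w x ∂μ) ^ 2 := by
  have hi : Integrable w μ := hw.integrable (by norm_num)
  have h1 : Integrable (fun p : α × α => w p.1 ^ 2) (μ.prod μ) := hw.integrable_sq.comp_fst μ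
  have h2 : Integrable (fun p : α × α => w p.2 ^ 2) (μ.prod μ) := hw.integrable_sq.comp_snd μ
  have h3 : Integrable (fun p : α × α => 2 * (w p.1 * w p.2)) (μ.prod μ) :=
    (hi.mul_prod hi).const_mul 2
  have e : (fun p : α × α => (w p.1 - w p.2) ^ 2) =
      fun p => w p.1 ^ 2 + w p.2 ^ 2 - 2 * (w p.1 * w p.2) := by
    ext p; ring
  rw [e]
  have h4 : Integrable (fun p : α × α => w p.1 ^ 2 + w p.2 ^ 2) (μ.prod μ) := h1.add h2
  refine ⟨h4.sub h3, ?_⟩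
  rw [integral_sub h4 h3, integral_add h1 h2, integral_const_mul, integral_prod_mul,
    integral_fun_fst (fun x => w x ^ 2), integral_fun_snd (fun x => w x ^ 2)]
  simp only [smul_eq_mul]
  ring

theorem norm_sq_eq_integral {α : Type*} [MeasurableSpace α] {μ : Measure α} (u : Lp ℝ 2 μ) :
    ‖u‖ ^ 2 = ∫ x, u x ^ 2 ∂μ := by
  rw [← real_inner_self_eq_norm_sq, L2.inner_def]
  simp

theorem memLp_restrict (u : Lp ℝ 2 (volume : Measure (E N))) (Q : Set (E N)) :
    MemLp u 2 (volume.restrict Q) := (Lp.memLp u).restrict Q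

theorem integral_sq_eq_cell (u : Lp ℝ 2 (volume : Measure (E N))) {Q : Set (E N)} {v : ℝ}
    (hv : 0 < v) (hQv : volume Q = ENNReal.ofReal v) :
    IntegrableOn (fun p : E N × E N => (u p.1 - u p.2) ^ 2) (Q ×ˢ Q) ∧
    ∫ x in Q, u x ^ 2 = (2 * v)⁻¹ * (∫ p in Q ×ˢ Q, (u p.1 - u p.2) ^ 2) +
      v⁻¹ * (∫ x in Q, u x) ^ 2 := by
  have : IsFiniteMeasure (volume.restrict Q) := ⟨by simp [hQv]⟩
  obtain ⟨h1, h2⟩ := integral_sq_difference (volume.restrict Q) (memLp_restrict u Q)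
  rw [Measure.prod_restrict, ← Measure.volume_eq_prod] at h1 h2
  refine ⟨h1, ?_⟩
  have hr : (volume.restrict Q).real Set.univ = v := by
    simp [Measure.real, hQv, hv.le]
  rw [h2, hr]
  field_simp
  ring

/-- At distance at most `d`, squared differences are controlled by the kernel. -/
theorem sq_difference_le {α p : ℝ} (hα : 0 < α) (hp : 0 < p)
    (hlow : ∀ x : E N, x ≠ 0 → α * ‖x‖ ^ (-p) ≤ K x) {d : ℝ} {x y : E N}
    (hxy : ‖x - y‖ ≤ d) (u : E N → ℝ) :
    (u x - u y) ^ 2 ≤ d ^ p / α * ((u x - u y) ^ 2 * K (x - y)) := by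
  by_cases h : x = y
  · simp [h]
  · have hn : 0 < ‖x - y‖ := norm_pos_iff.2 (sub_ne_zero.2 h)
    have hd : 0 < d := hn.trans_le hxy
    have h1 := hlow (x - y) (sub_ne_zero.2 h)
    have h2 : d ^ (-p) ≤ ‖x - y‖ ^ (-p) :=
      Real.rpow_le_rpow_of_nonpos hn hxy (by linarith)
    have h3 : 1 ≤ d ^ p / α * K (x - y) := by
      calc (1 : ℝ) = d ^ p / α * (α * d ^ (-p)) := by
            rw [Real.rpow_neg hd.le]; field_simp
        _ ≤ d ^ p / α * K (x - y) := by
            gcongr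
            exact (by gcongr : α * d ^ (-p) ≤ α * ‖x - y‖ ^ (-p)).trans h1
    calc (u x - u y) ^ 2 = (u x - u y) ^ 2 * 1 := by ring
      _ ≤ (u x - u y) ^ 2 * (d ^ p / α * K (x - y)) := by gcongr
      _ = _ := by ring

/-- On a cell of diameter at most `d` the lower bound on `K` controls the oscillation, and the
products `Q i ×ˢ Q i` are disjoint, so their energies sum to at most `form K u u`. What remains is
finitely many averages, whence both Poincaré (one large cell) and compactness (small cells). -/
theorem norm_sq_le_cells (hK : IsKernel K) {α p : ℝ} (hα : 0 < α) (hp : 0 < p)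
    (hlow : ∀ x : E N, x ≠ 0 → α * ‖x‖ ^ (-p) ≤ K x)
    {u : Lp ℝ 2 (volume : Measure (E N))} (hu : u ∈ X K Ω) {ι : Type*} (S : Finset ι)
    (Q : ι → Set (E N)) (hQm : ∀ i, MeasurableSet (Q i))
    (hQd : Pairwise (Function.onFun Disjoint Q)) (hΩQ : Ω ⊆ ⋃ i ∈ S, Q i) {v d : ℝ} (hv : 0 < v)
    (hQv : ∀ i, volume (Q i) = ENNReal.ofReal v) (hd0 : 0 ≤ d)
    (hd : ∀ i, ∀ x ∈ Q i, ∀ y ∈ Q i, ‖x - y‖ ≤ d) :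
    ‖u‖ ^ 2 ≤ (2 * v)⁻¹ * (d ^ p / α) * form K u u + v⁻¹ * ∑ i ∈ S, (∫ x in Q i, u x) ^ 2 := by
  have hsq : Integrable (fun x => u x ^ 2) volume := (Lp.memLp u).integrable_sq
  have h1 : ‖u‖ ^ 2 = ∑ i ∈ S, ∫ x in Q i, u x ^ 2 := by
    rw [norm_sq_eq_integral, ← integral_biUnion_finset S (fun i _ => hQm i)
      (fun i _ j _ hij => hQd hij) (fun i _ => hsq.integrableOn)]
    symm
    refine setIntegral_eq_integral_of_ae_compl_eq_zero ?_
    filter_upwards [hu.2] with x hx hxQ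
    rw [hx fun h => hxQ (hΩQ h)]
    simp
  have hcell := fun i => integral_sq_eq_cell u hv (hQv i)
  have hint := hu.1
  have h2 : ∀ i, ∫ p in Q i ×ˢ Q i, (u p.1 - u p.2) ^ 2 ≤
      (d ^ p / α) * ∫ p in Q i ×ˢ Q i, (u p.1 - u p.2) ^ 2 * K (p.1 - p.2) := by
    intro i
    rw [← integral_const_mul]
    refine setIntegral_mono_on (hcell i).1 (hint.integrableOn.const_mul _)
      ((hQm i).prod (hQm i)) ?_
    rintro ⟨x, y⟩ ⟨hx, hy⟩
    exact sq_difference_le hα hp hlow (hd i x hx y hy) u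
  have h3 : ∑ i ∈ S, ∫ p in Q i ×ˢ Q i, (u p.1 - u p.2) ^ 2 * K (p.1 - p.2) ≤ form K u u := by
    rw [form_self, ← integral_biUnion_finset S (fun i _ => (hQm i).prod (hQm i)) ?_
      (fun i _ => hint.integrableOn)]
    · refine setIntegral_le_integral hint ?_
      filter_upwards [hK.ae_difference_nonneg] with p hp
      exact mul_nonneg (sq_nonneg _) hp
    · intro i _ j _ hij
      exact Set.disjoint_prod.2 (Or.inl (hQd hij))
  rw [h1]
  calc ∑ i ∈ S, ∫ x in Q i, u x ^ 2
      = ∑ i ∈ S, ((2 * v)⁻¹ * (∫ p in Q i ×ˢ Q i, (u p.1 - u p.2) ^ 2) +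
        v⁻¹ * (∫ x in Q i, u x) ^ 2) := Finset.sum_congr rfl fun i _ => (hcell i).2
    _ ≤ ∑ i ∈ S, ((2 * v)⁻¹ * ((d ^ p / α) * ∫ p in Q i ×ˢ Q i,
          (u p.1 - u p.2) ^ 2 * K (p.1 - p.2)) + v⁻¹ * (∫ x in Q i, u x) ^ 2) := by
        gcongr with i _
        exact h2 i
    _ = (2 * v)⁻¹ * (d ^ p / α) * (∑ i ∈ S, ∫ p in Q i ×ˢ Q i,
          (u p.1 - u p.2) ^ 2 * K (p.1 - p.2)) + v⁻¹ * ∑ i ∈ S, (∫ x in Q i, u x) ^ 2 := by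
        rw [Finset.sum_add_distrib, ← Finset.mul_sum, ← Finset.mul_sum, ← Finset.mul_sum]
        ring
    _ ≤ _ := by gcongr

theorem sq_setIntegral_le (u : Lp ℝ 2 (volume : Measure (E N))) {Q : Set (E N)} {v : ℝ}
    (hv : 0 < v) (hQv : volume Q = ENNReal.ofReal v) : (∫ x in Q, u x) ^ 2 ≤ v * ‖u‖ ^ 2 := by
  have h := (integral_sq_eq_cell u hv hQv).2
  have h1 : 0 ≤ ∫ p in Q ×ˢ Q, (u p.1 - u p.2) ^ 2 :=
    integral_nonneg fun _ => sq_nonneg _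
  have h2 : ∫ x in Q, u x ^ 2 ≤ ‖u‖ ^ 2 := by
    rw [norm_sq_eq_integral]
    exact setIntegral_le_integral (Lp.memLp u).integrable_sq
      (Filter.Eventually.of_forall fun _ => sq_nonneg _)
  have h3 : v⁻¹ * (∫ x in Q, u x) ^ 2 ≤ ‖u‖ ^ 2 := by
    have : 0 ≤ (2 * v)⁻¹ * (∫ p in Q ×ˢ Q, (u p.1 - u p.2) ^ 2) := by positivity
    linarith
  rwa [inv_mul_le_iff₀ hv] at h3

theorem exists_kernel_bound (hK : IsKernel K) : ∃ α s : ℝ, 0 < α ∧ 0 < s ∧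
    ∀ x : E N, x ≠ 0 → α * ‖x‖ ^ (-((N : ℝ) + 2 * s)) ≤ K x := by
  obtain ⟨α, hα, s, hs, -, -, h⟩ := hK.lower_bound
  exact ⟨α, s, hα, hs, h⟩

/-- The Poincaré inequality. -/
theorem exists_poincare (hK : IsKernel K) (hΩ : Bornology.IsBounded Ω) :
    ∃ C : ℝ, 0 ≤ C ∧ ∀ u ∈ X K Ω, ‖u‖ ^ 2 ≤ C * form K u u := by
  obtain ⟨α, s, hα, hs, hlow⟩ := exists_kernel_bound hK
  obtain ⟨R, hR, hΩR⟩ := hΩ.subset_closedBall_lt 0 0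
  have hN := hK.dim_pos
  set c := volume.real (Metric.ball (0 : E N) 1) with hc
  have hc0 : 0 < c := ENNReal.toReal_pos (Metric.measure_ball_pos _ _ one_pos).ne'
    measure_ball_lt_top.ne
  have hvol : ∀ r : ℝ, 0 < r →
      volume (Metric.closedBall (0 : E N) r) = ENNReal.ofReal (r ^ N * c) := by
    intro r hr
    rw [Measure.addHaar_closedBall _ _ hr.le, ENNReal.ofReal_mul (by positivity), hc,
      ofReal_measureReal measure_ball_lt_top.ne]
    simp
  -- The single cell is a ball of twice the radius: the mass of `u` sits in the smaller ball, of at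
  -- most half the volume as `N ≥ 1`, so the mean term is at most `‖u‖²/2` and is absorbed.
  set v := (2 * R) ^ N * c with hv
  have hv0 : 0 < v := by positivity
  have hvR : 2 * (R ^ N * c) ≤ v := by
    rw [hv, mul_pow, mul_assoc]
    have : (2 : ℝ) ≤ 2 ^ N := by
      calc (2 : ℝ) = 2 ^ 1 := by norm_num
        _ ≤ 2 ^ N := pow_le_pow_right₀ (by norm_num) hN
    gcongr
  have hsub : Metric.closedBall (0 : E N) R ⊆ Metric.closedBall 0 (2 * R) :=
    Metric.closedBall_subset_closedBall (by linarith)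
  refine ⟨2 * ((2 * v)⁻¹ * ((4 * R) ^ ((N : ℝ) + 2 * s) / α)), by positivity, fun u hu => ?_⟩
  have h1 := norm_sq_le_cells hK hα (by positivity) hlow hu (Finset.univ : Finset Unit)
    (fun _ => Metric.closedBall (0 : E N) (2 * R)) (fun _ => measurableSet_closedBall)
    (fun i j hij => (hij rfl).elim) (fun x hx => by simpa using hsub (hΩR hx)) hv0
    (fun _ => hvol _ (by positivity)) (d := 4 * R) (by positivity) (by
      intro _ x hx y hy
      rw [mem_closedBall_zero_iff] at hx hy
      linarith [norm_sub_le x y])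
  have h2 : ∫ x in Metric.closedBall (0 : E N) (2 * R), u x =
      ∫ x in Metric.closedBall (0 : E N) R, u x := by
    refine (setIntegral_eq_of_subset_of_ae_sdiff_eq_zero
      measurableSet_closedBall.nullMeasurableSet hsub ?_)
    filter_upwards [hu.2] with x hx hxQ
    exact hx fun h => hxQ.2 (hΩR h)
  have h3 := sq_setIntegral_le u (by positivity) (hvol R hR)
  simp only [Finset.univ_unique, Finset.sum_const, Finset.card_singleton, one_smul] at h1
  rw [h2] at h1
  have h4 : v⁻¹ * (∫ x in Metric.closedBall (0 : E N) R, u x) ^ 2 ≤ ‖u‖ ^ 2 / 2 := by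
    rw [inv_mul_le_iff₀ hv0]
    nlinarith [mul_le_mul_of_nonneg_right hvR (sq_nonneg ‖u‖)]
  linarith

/-! ### The Hilbert space `X_K(Ω)`. -/

/-- `X_K(Ω)` as a type of its own, to be normed by the scalar product `form K`. -/
def XSpace (hK : IsKernel K) (_ : Bornology.IsBounded Ω) : Type := XSubmodule hK Ω

namespace XSpace

variable (hK : IsKernel K) (hΩ : Bornology.IsBounded Ω)

noncomputable instance : AddCommGroup (XSpace hK hΩ) :=
  inferInstanceAs (AddCommGroup (XSubmodule hK Ω))

noncomputable instance : Module ℝ (XSpace hK hΩ) :=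
  inferInstanceAs (Module ℝ (XSubmodule hK Ω))

/-- The underlying element of `L²`. -/
noncomputable def val : XSpace hK hΩ →ₗ[ℝ] Lp ℝ 2 (volume : Measure (E N)) :=
  (XSubmodule hK Ω).subtype

/-- The weighted difference of an element of `X_K(Ω)`. -/
noncomputable def diff : XSpace hK hΩ →ₗ[ℝ] Lp ℝ 2 (volume : Measure (E N × E N)) :=
  wdiffLp hK Ω

variable {hK hΩ}

theorem val_mem (u : XSpace hK hΩ) : val hK hΩ u ∈ X K Ω := Subtype.property (p := (· ∈ X K Ω)) u

theorem val_injective : Function.Injective (val hK hΩ) := Subtype.val_injective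

theorem exists_val_eq {u : Lp ℝ 2 (volume : Measure (E N))} (hu : u ∈ X K Ω) :
    ∃ x : XSpace hK hΩ, val hK hΩ x = u := ⟨(⟨u, hu⟩ : XSubmodule hK Ω), rfl⟩

theorem coeFn_diff (u : XSpace hK hΩ) : diff hK hΩ u =ᵐ[volume] wdiff K (val hK hΩ u) :=
  coeFn_wdiffLp hK _

theorem inner_diff (u v : XSpace hK hΩ) :
    inner ℝ (diff hK hΩ u) (diff hK hΩ v) = form K (val hK hΩ u) (val hK hΩ v) :=
  inner_wdiffLp hK _ _

variable (hK hΩ)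

/-- The scalar product of `X_K(Ω)`. -/
@[reducible]
noncomputable def core : InnerProductSpace.Core ℝ (XSpace hK hΩ) where
  inner u v := inner ℝ (diff hK hΩ u) (diff hK hΩ v)
  conj_inner_symm u v := by simp [real_inner_comm]
  re_inner_nonneg u := by simp
  add_left u v w := by rw [map_add, inner_add_left]
  smul_left u v r := by rw [map_smul, inner_smul_left]
  definite u h := by
    obtain ⟨C, -, hC⟩ := exists_poincare hK hΩ
    have h1 := hC _ (val_mem u)
    rw [← inner_diff, h, mul_zero] at h1
    have h2 : ‖val hK hΩ u‖ = 0 := by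
      have := le_antisymm h1 (sq_nonneg _)
      simpa using this
    exact val_injective ((norm_eq_zero.1 h2).trans (map_zero _).symm)

noncomputable instance : NormedAddCommGroup (XSpace hK hΩ) :=
  @InnerProductSpace.Core.toNormedAddCommGroup ℝ _ _ _ _ (core hK hΩ)

noncomputable instance : InnerProductSpace ℝ (XSpace hK hΩ) :=
  InnerProductSpace.ofCore (core hK hΩ).toCore

variable {hK hΩ}

theorem inner_eq_form (u v : XSpace hK hΩ) :
    inner ℝ u v = form K (val hK hΩ u) (val hK hΩ v) := inner_diff u v

theorem norm_sq_eq_form (u : XSpace hK hΩ) : ‖u‖ ^ 2 = form K (val hK hΩ u) (val hK hΩ u) := by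
  rw [← real_inner_self_eq_norm_sq, inner_eq_form]

theorem norm_diff (u : XSpace hK hΩ) : ‖diff hK hΩ u‖ = ‖u‖ := by
  rw [← sq_eq_sq₀ (norm_nonneg _) (norm_nonneg _), norm_sq_eq_form, ← inner_diff,
    real_inner_self_eq_norm_sq]

variable (hK hΩ)

theorem exists_norm_val_le : ∃ C : ℝ, 0 ≤ C ∧ ∀ u : XSpace hK hΩ, ‖val hK hΩ u‖ ≤ C * ‖u‖ := by
  obtain ⟨C, hC0, hC⟩ := exists_poincare hK hΩ
  refine ⟨Real.sqrt C, Real.sqrt_nonneg _, fun u => ?_⟩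
  refine le_of_sq_le_sq ?_ (by positivity)
  rw [mul_pow, Real.sq_sqrt hC0, norm_sq_eq_form]
  exact hC _ (val_mem u)

/-- The continuous embedding of `X_K(Ω)` into `L²`. -/
noncomputable def incl : XSpace hK hΩ →L[ℝ] Lp ℝ 2 (volume : Measure (E N)) :=
  (val hK hΩ).mkContinuousOfExistsBound
    ((exists_norm_val_le hK hΩ).imp fun _ h => h.2)

theorem incl_apply (u : XSpace hK hΩ) : incl hK hΩ u = val hK hΩ u := rfl

/-- The weighted difference as an isometry. -/
noncomputable def diffIsometry :
    XSpace hK hΩ →ₗᵢ[ℝ] Lp ℝ 2 (volume : Measure (E N × E N)) :=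
  ⟨diff hK hΩ, norm_diff⟩

-- For a Cauchy sequence, the functions converge in `L²` (Poincaré) and their weighted differences
-- in `L²(ℝ^{2N})`. Almost everywhere convergence along a common subsequence identifies the second
-- limit as the weighted difference of the first.
open Filter Topology in
instance : CompleteSpace (XSpace hK hΩ) := by
  refine Metric.complete_of_cauchySeq_tendsto fun u hu => ?_
  obtain ⟨w, hw⟩ := cauchySeq_tendsto_of_complete
    ((diffIsometry hK hΩ).isometry.uniformContinuous.comp_cauchySeq hu)
  obtain ⟨z, hz⟩ := cauchySeq_tendsto_of_complete
    ((incl hK hΩ).uniformContinuous.comp_cauchySeq hu)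
  obtain ⟨n, hn, hzae⟩ := (tendstoInMeasure_of_tendsto_Lp hz).exists_seq_tendsto_ae
  obtain ⟨k, hk, hwae⟩ := (tendstoInMeasure_of_tendsto_Lp
    (hw.comp hn.tendsto_atTop)).exists_seq_tendsto_ae
  have hwz : w =ᵐ[volume] wdiff K z := by
    have hd : ∀ᵐ p : E N × E N, ∀ i, diff hK hΩ (u i) p = wdiff K (val hK hΩ (u i)) p :=
      ae_all_iff.2 fun i => coeFn_diff (u i)
    filter_upwards [hwae, hd, quasiMeasurePreserving_fst_volume.ae hzae,
      quasiMeasurePreserving_snd_volume.ae hzae] with p h1 h2 h3 h4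
    refine tendsto_nhds_unique h1 ?_
    have h5 := (((h3.sub h4).mul_const (Real.sqrt (K (p.1 - p.2)))).comp hk.tendsto_atTop)
    exact h5.congr fun i => (h2 _).symm
  have hzX : z ∈ X K Ω := by
    refine ⟨(hK.memLp_wdiff_iff (Lp.aestronglyMeasurable _)).1 ((Lp.memLp w).ae_eq hwz), ?_⟩
    have h0 : ∀ᵐ x : E N, ∀ i, x ∉ Ω → val hK hΩ (u i) x = 0 :=
      ae_all_iff.2 fun i => (val_mem (u i)).2
    filter_upwards [hzae, h0] with x h1 h2 hx
    refine tendsto_nhds_unique h1 ?_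
    exact tendsto_const_nhds.congr fun i => (h2 _ hx).symm
  obtain ⟨a, ha⟩ := exists_val_eq (hK := hK) (hΩ := hΩ) hzX
  refine ⟨a, ?_⟩
  have hwa : w = diffIsometry hK hΩ a := by
    refine Lp.ext (hwz.trans ?_)
    rw [← ha]
    exact (coeFn_diff a).symm
  rw [hwa] at hw
  exact (diffIsometry hK hΩ).isometry.isUniformInducing.isInducing.tendsto_nhds_iff.2 hw

end XSpace

/-! ### Cubic grids and the compact embedding into `L²`. -/

/-- The cells of the cubic grid of mesh size `h`. -/
def gridCell (h : ℝ) (z : Fin N → ℤ) : Set (E N) := {x | ∀ i, ⌊x i / h⌋ = z i}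

theorem measurableSet_gridCell (h : ℝ) (z : Fin N → ℤ) : MeasurableSet (gridCell h z) := by
  have : gridCell h z = ⋂ i, {x : E N | ⌊x i / h⌋ = z i} := by
    ext x; simp [gridCell]
  rw [this]
  refine MeasurableSet.iInter fun i => ?_
  have hm : Measurable fun x : E N => ⌊x i / h⌋ := by fun_prop
  exact hm (measurableSet_singleton (z i))

theorem pairwise_disjoint_gridCell (h : ℝ) :
    Pairwise (Function.onFun Disjoint (gridCell (N := N) h)) := by
  intro z z' hzz'
  refine Set.disjoint_left.2 fun x hx hx' => hzz' ?_
  ext i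
  rw [← hx i, ← hx' i]

theorem volume_gridCell {h : ℝ} (hh : 0 < h) (z : Fin N → ℤ) :
    volume (gridCell h z) = ENNReal.ofReal (h ^ N) := by
  have hpre : gridCell h z = (MeasurableEquiv.toLp 2 (Fin N → ℝ)).symm ⁻¹'
      (Set.univ.pi fun i => Set.Ico (z i * h) ((z i + 1) * h)) := by
    ext x
    simp only [gridCell, Set.mem_ofPred_eq, Set.mem_preimage, Set.mem_univ_pi, Set.mem_Ico,
      Int.floor_eq_iff, le_div_iff₀ hh, div_lt_iff₀ hh]
    rfl
  rw [hpre, (EuclideanSpace.volume_preserving_symm_measurableEquiv_toLp (Fin N)).measure_preimage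
    (MeasurableSet.univ_pi fun i => measurableSet_Ico).nullMeasurableSet, Real.volume_pi_Ico]
  have : ∀ i, (z i + 1) * h - z i * h = h := fun i => by ring
  simp [this, ENNReal.ofReal_pow hh.le]

theorem norm_sub_le_of_mem_gridCell {h : ℝ} (hh : 0 < h) {z : Fin N → ℤ} {x y : E N}
    (hx : x ∈ gridCell h z) (hy : y ∈ gridCell h z) : ‖x - y‖ ≤ Real.sqrt N * h := by
  rw [EuclideanSpace.norm_eq]
  refine Real.sqrt_le_iff.2 ⟨by positivity, ?_⟩
  have h1 : ∀ i, ‖(x - y) i‖ ^ 2 ≤ h ^ 2 := by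
    intro i
    have h1 := (Int.floor_eq_iff.1 (hx i))
    have h2 := (Int.floor_eq_iff.1 (hy i))
    rw [le_div_iff₀ hh, div_lt_iff₀ hh] at h1 h2
    rw [Real.norm_eq_abs]
    gcongr
    rw [PiLp.sub_apply, abs_le]
    constructor <;> linarith [h1.1, h1.2, h2.1, h2.2]
  calc ∑ i, ‖(x - y) i‖ ^ 2 ≤ ∑ _i : Fin N, h ^ 2 := Finset.sum_le_sum fun i _ => h1 i
    _ = (Real.sqrt N * h) ^ 2 := by
      rw [mul_pow, Real.sq_sqrt (by positivity)]; simp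

theorem exists_gridCell_cover (hΩ : Bornology.IsBounded Ω) {h : ℝ} (hh : 0 < h) :
    ∃ S : Finset (Fin N → ℤ), Ω ⊆ ⋃ z ∈ S, gridCell h z := by
  obtain ⟨R, hR⟩ := hΩ.exists_norm_le
  refine ⟨Fintype.piFinset fun _ => Finset.Icc ⌊-R / h⌋ ⌊R / h⌋, fun x hx => ?_⟩
  refine Set.mem_biUnion (x := fun i => ⌊x i / h⌋) ?_ fun i => rfl
  simp only [Finset.mem_coe, Fintype.mem_piFinset, Finset.mem_Icc]
  intro i
  have h1 : |x i| ≤ R := (PiLp.norm_apply_le x i).trans (hR x hx)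
  rw [abs_le] at h1
  exact ⟨Int.floor_mono (by gcongr; exact h1.1), Int.floor_mono (by gcongr; exact h1.2)⟩

-- Up to `ε`, an element of the unit ball is determined by its integrals over finitely many small
-- cells, rounded to precision `η`; so the image of the ball is totally bounded.
open Filter Topology in
theorem XSpace.isCompactOperator_incl (hK : IsKernel K) (hΩ : Bornology.IsBounded Ω) :
    IsCompactOperator (incl hK hΩ) := by
  have htb : TotallyBounded (incl hK hΩ '' Metric.closedBall 0 1) := by
    obtain ⟨α, s, hα, hs, hlow⟩ := exists_kernel_bound hK
    obtain ⟨C, hC0, hC⟩ := exists_norm_val_le hK hΩ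
    have hN := hK.dim_pos
    refine Metric.totallyBounded_of_finite_discretization fun ε hε => ?_
    -- The oscillation factor scales like `h^{N + 2s} / h^N = h^{2s}`. The `4` bounds the energy of
    -- a difference of two elements of the unit ball.
    obtain ⟨h, hh, hsmall⟩ : ∃ h : ℝ, 0 < h ∧ (2 * h ^ N)⁻¹ *
        ((Real.sqrt N * h) ^ ((N : ℝ) + 2 * s) / α) * 4 < ε ^ 2 / 2 := by
      have hlim : Tendsto (fun h : ℝ => (2 * α)⁻¹ * Real.sqrt N ^ ((N : ℝ) + 2 * s) *
          h ^ (2 * s) * 4) (𝓝[>] 0) (𝓝 0) := by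
        have h1 : Tendsto (fun h : ℝ => h ^ (2 * s)) (𝓝[>] 0) (𝓝 0) := by
          have := (Real.continuousAt_rpow_const 0 (2 * s) (Or.inr (by positivity))).tendsto
          rw [Real.zero_rpow (by positivity)] at this
          exact this.mono_left nhdsWithin_le_nhds
        simpa using (h1.const_mul ((2 * α)⁻¹ * Real.sqrt N ^ ((N : ℝ) + 2 * s))).mul_const 4
      have hev := hlim.eventually_lt_const (show (0 : ℝ) < ε ^ 2 / 2 by positivity)
      obtain ⟨h, hlt, hh⟩ := (hev.and self_mem_nhdsWithin).exists
      have hh : 0 < h := hh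
      refine ⟨h, hh, lt_of_eq_of_lt ?_ hlt⟩
      rw [Real.mul_rpow (Real.sqrt_nonneg _) hh.le, Real.rpow_add hh, Real.rpow_natCast]
      field_simp
    obtain ⟨S, hS⟩ := exists_gridCell_cover hΩ hh
    set v := h ^ N with hv
    have hv0 : 0 < v := by positivity
    obtain ⟨η, hη, hηS⟩ : ∃ η : ℝ, 0 < η ∧ v⁻¹ * (S.card * η ^ 2) < ε ^ 2 / 2 := by
      have hlim : Tendsto (fun η : ℝ => v⁻¹ * (S.card * η ^ 2)) (𝓝[>] 0) (𝓝 0) := by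
        have : Continuous (fun η : ℝ => v⁻¹ * (S.card * η ^ 2)) := by fun_prop
        have := this.tendsto 0
        simp only [ne_eq, OfNat.ofNat_ne_zero, not_false_eq_true, zero_pow, mul_zero] at this
        exact this.mono_left nhdsWithin_le_nhds
      have hev := hlim.eventually_lt_const (show (0 : ℝ) < ε ^ 2 / 2 by positivity)
      obtain ⟨η, hlt, hη⟩ := (hev.and self_mem_nhdsWithin).exists
      exact ⟨η, hη, hlt⟩
    have hmean : ∀ u : XSpace hK hΩ, ‖u‖ ≤ 1 → ∀ z,
        |∫ x in gridCell h z, val hK hΩ u x| ≤ Real.sqrt v * C := by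
      intro u hu z
      have h1 := sq_setIntegral_le (val hK hΩ u) hv0 (volume_gridCell hh z)
      refine abs_le_of_sq_le_sq (h1.trans ?_) (by positivity)
      rw [mul_pow, Real.sq_sqrt hv0.le]
      gcongr
      calc _ ≤ C * ‖u‖ := hC u
        _ ≤ C := mul_le_of_le_one_right hC0 hu
    set R := Real.sqrt v * C
    refine ⟨S → Finset.Icc ⌊-R / η⌋ ⌊R / η⌋, inferInstance, fun x z =>
      ⟨⌊(∫ y in gridCell h z, (x : Lp ℝ 2 (volume : Measure (E N))) y) / η⌋, ?_⟩, ?_⟩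
    · obtain ⟨u, hu, hux⟩ := x.2
      have h1 := hmean u (by simpa using hu) z
      rw [← hux, incl_apply, Finset.mem_Icc]
      rw [abs_le] at h1
      exact ⟨Int.floor_mono (by gcongr; exact h1.1), Int.floor_mono (by gcongr; exact h1.2)⟩
    · rintro ⟨_, u, hu, rfl⟩ ⟨_, w, hw, rfl⟩ huw
      have hu1 : ‖u‖ ≤ 1 := by simpa using hu
      have hw1 : ‖w‖ ≤ 1 := by simpa using hw
      have hcells := norm_sq_le_cells hK hα (by positivity) hlow (val_mem (u - w)) S (gridCell h)
        (measurableSet_gridCell h) (pairwise_disjoint_gridCell h) hS hv0 (volume_gridCell hh)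
        (d := Real.sqrt N * h) (by positivity)
        (fun z x hx y hy => norm_sub_le_of_mem_gridCell hh hx hy)
      have hform : form K (val hK hΩ (u - w)) (val hK hΩ (u - w)) ≤ 4 := by
        rw [← norm_sq_eq_form]
        have h2 : ‖u - w‖ ≤ 2 := (norm_sub_le u w).trans (by linarith)
        calc ‖u - w‖ ^ 2 ≤ 2 ^ 2 := by gcongr
          _ = 4 := by norm_num
      have hdiff : ∀ z ∈ S, (∫ x in gridCell h z, val hK hΩ (u - w) x) ^ 2 ≤ η ^ 2 := by
        intro z hz
        have : IsFiniteMeasure (volume.restrict (gridCell h z)) :=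
          ⟨by simp [volume_gridCell hh z]⟩
        have hi : ∀ f : Lp ℝ 2 (volume : Measure (E N)), IntegrableOn f (gridCell h z) :=
          fun f => (memLp_restrict f _).integrable (by norm_num)
        have h1 : ∫ x in gridCell h z, val hK hΩ (u - w) x =
            (∫ x in gridCell h z, val hK hΩ u x) - ∫ x in gridCell h z, val hK hΩ w x := by
          rw [← integral_sub (hi _) (hi _), map_sub]
          exact integral_congr_ae (ae_restrict_of_ae (Lp.coeFn_sub _ _))
        have h2 := congrArg Subtype.val (congrFun huw ⟨z, hz⟩)
        have h3 := Int.abs_sub_lt_one_of_floor_eq_floor h2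
        simp only [incl_apply] at h3
        rw [← sub_div, abs_div, abs_of_pos hη, div_lt_one hη] at h3
        rw [h1, ← sq_abs]
        gcongr
      have hsum : ∑ z ∈ S, (∫ x in gridCell h z, val hK hΩ (u - w) x) ^ 2 ≤ S.card * η ^ 2 := by
        simpa using Finset.sum_le_sum hdiff
      have hlt : ‖val hK hΩ (u - w)‖ ^ 2 < ε ^ 2 := by
        calc _ ≤ _ := hcells
          _ ≤ (2 * v)⁻¹ * ((Real.sqrt N * h) ^ ((N : ℝ) + 2 * s) / α) * 4 +
              v⁻¹ * (S.card * η ^ 2) := by gcongr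
          _ < ε ^ 2 / 2 + ε ^ 2 / 2 := by gcongr
          _ = ε ^ 2 := by ring
      rw [dist_eq_norm, ← map_sub, incl_apply]
      exact lt_of_pow_lt_pow_left₀ 2 hε.le hlt
  refine ⟨closure (incl hK hΩ '' Metric.closedBall 0 1),
    isCompact_iff_totallyBounded_isComplete.2 ⟨htb.closure, isClosed_closure.isComplete⟩, ?_⟩
  filter_upwards [Metric.closedBall_mem_nhds (0 : XSpace hK hΩ) one_pos] with x hx
  exact subset_closure ⟨x, hx, rfl⟩

/-! ### The weighted form `∫_Ω ρ u v`. -/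

theorem exists_ae_abs_le (ρ : Lp ℝ ∞ (volume.restrict Ω)) :
    ∃ C : ℝ, 0 ≤ C ∧ ∀ᵐ x ∂volume.restrict Ω, ‖ρ x‖ ≤ C := by
  refine ⟨(eLpNormEssSup ρ (volume.restrict Ω)).toReal, ENNReal.toReal_nonneg, ?_⟩
  have hfin : eLpNormEssSup ρ (volume.restrict Ω) ≠ ⊤ := by
    rw [← eLpNorm_exponent_top]
    exact Lp.eLpNorm_ne_top ρ
  filter_upwards [ae_le_eLpNormEssSup (f := ρ) (μ := volume.restrict Ω)] with x hx
  rw [← toReal_enorm]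
  exact ENNReal.toReal_mono hfin hx

theorem integrable_mul_Lp (u v : Lp ℝ 2 (volume : Measure (E N))) :
    Integrable (fun x => u x * v x) volume :=
  (Lp.memLp u).integrable_mul (Lp.memLp v)

theorem integrable_weight (ρ : Lp ℝ ∞ (volume.restrict Ω))
    (u v : Lp ℝ 2 (volume : Measure (E N))) :
    Integrable (fun x => ρ x * (u x * v x)) (volume.restrict Ω) := by
  obtain ⟨C, -, hC⟩ := exists_ae_abs_le ρ
  exact (integrable_mul_Lp u v).integrableOn.bdd_mul (Lp.aestronglyMeasurable ρ) hC

theorem integral_abs_mul_le (u v : Lp ℝ 2 (volume : Measure (E N))) :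
    ∫ x, |u x * v x| ≤ ‖u‖ * ‖v‖ := by
  have h1 : ∫ x, |u x * v x| = inner ℝ |u| |v| := by
    rw [L2.inner_def]
    refine integral_congr_ae ?_
    filter_upwards [Lp.coeFn_abs u, Lp.coeFn_abs v] with x hu hv
    rw [hu, hv, abs_mul]
    simp [mul_comm]
  rw [h1, ← norm_abs_eq_norm u, ← norm_abs_eq_norm v]
  exact real_inner_le_norm _ _

theorem abs_weight_le (ρ : Lp ℝ ∞ (volume.restrict Ω)) {C : ℝ} (hC0 : 0 ≤ C)
    (hC : ∀ᵐ x ∂volume.restrict Ω, ‖ρ x‖ ≤ C) (u v : Lp ℝ 2 (volume : Measure (E N))) :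
    |∫ x in Ω, ρ x * (u x * v x)| ≤ C * (‖u‖ * ‖v‖) := by
  have hi := (integrable_mul_Lp u v).abs
  calc |∫ x in Ω, ρ x * (u x * v x)| ≤ ∫ x in Ω, |ρ x * (u x * v x)| := abs_integral_le_integral_abs
    _ ≤ ∫ x in Ω, C * |u x * v x| := by
        refine integral_mono_ae (integrable_weight ρ u v).abs (hi.integrableOn.const_mul C) ?_
        filter_upwards [hC] with x hx
        rw [abs_mul]
        gcongr
        exact hx
    _ = C * ∫ x in Ω, |u x * v x| := integral_const_mul _ _
    _ ≤ C * ∫ x, |u x * v x| := by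
        exact mul_le_mul_of_nonneg_left (setIntegral_le_integral hi
          (Filter.Eventually.of_forall fun _ => abs_nonneg _)) hC0
    _ ≤ C * (‖u‖ * ‖v‖) := by gcongr; exact integral_abs_mul_le u v

/-- The weighted form `(u, v) ↦ ∫_Ω ρ u v` on `L²`, as a bilinear map. -/
noncomputable def weightBilin (ρ : Lp ℝ ∞ (volume.restrict Ω)) :
    Lp ℝ 2 (volume : Measure (E N)) →ₗ[ℝ] Lp ℝ 2 (volume : Measure (E N)) →ₗ[ℝ] ℝ :=
  LinearMap.mk₂ ℝ (fun u v => ∫ x in Ω, ρ x * (u x * v x))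
    (fun u u' v => by
      rw [← integral_add (integrable_weight ρ u v) (integrable_weight ρ u' v)]
      refine integral_congr_ae (ae_restrict_of_ae ?_)
      filter_upwards [Lp.coeFn_add u u'] with x hx
      rw [hx, Pi.add_apply]; ring)
    (fun c u v => by
      rw [smul_eq_mul, ← integral_const_mul]
      refine integral_congr_ae (ae_restrict_of_ae ?_)
      filter_upwards [Lp.coeFn_smul c u] with x hx
      rw [hx, Pi.smul_apply, smul_eq_mul]; ring)
    (fun u v v' => by
      rw [← integral_add (integrable_weight ρ u v) (integrable_weight ρ u v')]
      refine integral_congr_ae (ae_restrict_of_ae ?_)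
      filter_upwards [Lp.coeFn_add v v'] with x hx
      rw [hx, Pi.add_apply]; ring)
    (fun c u v => by
      rw [smul_eq_mul, ← integral_const_mul]
      refine integral_congr_ae (ae_restrict_of_ae ?_)
      filter_upwards [Lp.coeFn_smul c v] with x hx
      rw [hx, Pi.smul_apply, smul_eq_mul]; ring)

theorem exists_weightBilin_le (ρ : Lp ℝ ∞ (volume.restrict Ω)) :
    ∃ C : ℝ, ∀ u v, ‖weightBilin ρ u v‖ ≤ C * ‖u‖ * ‖v‖ := by
  obtain ⟨C, hC0, hC⟩ := exists_ae_abs_le ρ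
  refine ⟨C, fun u v => ?_⟩
  rw [mul_assoc]
  exact abs_weight_le ρ hC0 hC u v

/-- The weighted form `(u, v) ↦ ∫_Ω ρ u v` on `L²`. -/
noncomputable def weightFormLp (ρ : Lp ℝ ∞ (volume.restrict Ω)) :
    Lp ℝ 2 (volume : Measure (E N)) →L[ℝ] Lp ℝ 2 (volume : Measure (E N)) →L[ℝ] ℝ :=
  (weightBilin ρ).mkContinuous₂ _ (exists_weightBilin_le ρ).choose_spec

namespace XSpace

variable (hK : IsKernel K) (hΩ : Bornology.IsBounded Ω)

/-- The weighted form `(u, v) ↦ ∫_Ω ρ u v` on `X_K(Ω)`. -/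
noncomputable def weightForm (ρ : Lp ℝ ∞ (volume.restrict Ω)) :
    XSpace hK hΩ →L[ℝ] XSpace hK hΩ →L[ℝ] ℝ :=
  (weightFormLp ρ).bilinearComp (incl hK hΩ) (incl hK hΩ)

theorem weightForm_apply (ρ : Lp ℝ ∞ (volume.restrict Ω)) (u v : XSpace hK hΩ) :
    weightForm hK hΩ ρ u v = ∫ x in Ω, ρ x * (val hK hΩ u x * val hK hΩ v x) := rfl

theorem weightForm_symm (ρ : Lp ℝ ∞ (volume.restrict Ω)) (u v : XSpace hK hΩ) :
    weightForm hK hΩ ρ u v = weightForm hK hΩ ρ v u := by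
  simp only [weightForm_apply, mul_comm (val hK hΩ u _)]

theorem weightForm_self (ρ : Lp ℝ ∞ (volume.restrict Ω)) (u : XSpace hK hΩ) :
    weightForm hK hΩ ρ u u = ∫ x in Ω, ρ x * val hK hΩ u x ^ 2 := by
  simp only [weightForm_apply, sq]

theorem weightForm_self_le (ρ : Lp ℝ ∞ (volume.restrict Ω)) {C : ℝ} (hC0 : 0 ≤ C)
    (hC : ∀ᵐ x ∂volume.restrict Ω, ‖ρ x‖ ≤ C) (u : XSpace hK hΩ) :
    weightForm hK hΩ ρ u u ≤ C * ‖incl hK hΩ u‖ ^ 2 := by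
  rw [sq]
  exact (le_abs_self _).trans (abs_weight_le ρ hC0 hC (val hK hΩ u) (val hK hΩ u))

theorem weightForm_neg (ρ : Lp ℝ ∞ (volume.restrict Ω)) (u v : XSpace hK hΩ) :
    weightForm hK hΩ (-ρ) u v = -weightForm hK hΩ ρ u v := by
  rw [weightForm_apply, weightForm_apply, ← integral_neg]
  refine integral_congr_ae ?_
  filter_upwards [Lp.coeFn_neg ρ] with x hx
  rw [hx, Pi.neg_apply]; ring

theorem weightForm_mono {ρ ρ' : Lp ℝ ∞ (volume.restrict Ω)} (hle : ρ ≤ ρ') (u : XSpace hK hΩ) :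
    weightForm hK hΩ ρ u u ≤ weightForm hK hΩ ρ' u u := by
  refine integral_mono_ae (integrable_weight ρ _ _) (integrable_weight ρ' _ _) ?_
  filter_upwards [(Lp.coeFn_le ρ ρ').2 hle] with x hx
  exact mul_le_mul_of_nonneg_right hx (mul_self_nonneg _)

/-- Equality would force the nonnegative function `(ρ' - ρ)u²` to vanish a.e. in `Ω`, hence `ρ =
ρ'`, as `u ≠ 0` a.e. there. -/
theorem weightForm_lt {ρ ρ' : Lp ℝ ∞ (volume.restrict Ω)} (hΩm : MeasurableSet Ω) (hle : ρ ≤ ρ')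
    (hne : ρ ≠ ρ') (u : XSpace hK hΩ) (hu : volume {x ∈ Ω | val hK hΩ u x = 0} = 0) :
    weightForm hK hΩ ρ u u < weightForm hK hΩ ρ' u u := by
  refine lt_of_le_of_ne (weightForm_mono hK hΩ hle u) fun heq => hne ?_
  have hi := integrable_weight ρ (val hK hΩ u) (val hK hΩ u)
  have hi' := integrable_weight ρ' (val hK hΩ u) (val hK hΩ u)
  have h0 : ∫ x in Ω, (ρ' x * (val hK hΩ u x * val hK hΩ u x) -
      ρ x * (val hK hΩ u x * val hK hΩ u x)) = 0 := by
    rw [integral_sub hi' hi, ← weightForm_apply, ← weightForm_apply, heq, sub_self]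
  have hi'' : Integrable (fun x => ρ' x * (val hK hΩ u x * val hK hΩ u x) -
      ρ x * (val hK hΩ u x * val hK hΩ u x)) (volume.restrict Ω) := hi'.sub hi
  rw [integral_eq_zero_iff_of_nonneg_ae ?_ hi''] at h0
  · refine Lp.ext ?_
    have hu' : ∀ᵐ x ∂volume.restrict Ω, val hK hΩ u x ≠ 0 := by
      rw [ae_restrict_iff' hΩm]
      filter_upwards [measure_eq_zero_iff_ae_notMem.1 hu] with x hx hxΩ hx0
      exact hx ⟨hxΩ, hx0⟩
    filter_upwards [h0, hu'] with x hx hx0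
    have h1 : (ρ' x - ρ x) * (val hK hΩ u x * val hK hΩ u x) = 0 := by
      rw [sub_mul]; exact hx
    rcases mul_eq_zero.1 h1 with h2 | h2
    · linarith
    · exact (hx0 (mul_self_eq_zero.1 h2)).elim
  · filter_upwards [(Lp.coeFn_le ρ ρ').2 hle] with x hx
    exact sub_nonneg.2 (mul_le_mul_of_nonneg_right hx (mul_self_nonneg _))

/-- The minimax value is the reciprocal of the eigenvalue in the weak equation, hence `m⁻¹`. -/
theorem isEigenfunction_of_isFormEigen {ρ : Lp ℝ ∞ (volume.restrict Ω)} {m : ℝ} (hm : 0 < m)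
    {u : XSpace hK hΩ} (hu0 : u ≠ 0) (hu : IsFormEigen (weightForm hK hΩ ρ) m u) :
    IsEigenfunction K Ω ρ m⁻¹ (val hK hΩ u) := by
  refine ⟨val_mem u, fun h => hu0 (val_injective (h.trans (map_zero _).symm)), fun v hv => ?_⟩
  obtain ⟨v, rfl⟩ := exists_val_eq (hK := hK) (hΩ := hΩ) hv
  rw [← weightForm_apply, hu v, inner_eq_form]
  field_simp

end XSpace

/-! ### Subspaces of any dimension on which the weighted form is positive. -/

/-- A family orthogonal for `b` on which `b` is positive spans a subspace where `b` is positive. -/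
theorem exists_positive_subspace {H : Type*} [NormedAddCommGroup H] [InnerProductSpace ℝ H]
    (b : H →L[ℝ] H →L[ℝ] ℝ) {ι : Type*} [Fintype ι] (f : ι → H)
    (horth : ∀ i j, i ≠ j → b (f i) (f j) = 0) (hpos : ∀ i, 0 < b (f i) (f i)) :
    ∃ F : Submodule ℝ H, Fintype.card ι ≤ Module.finrank ℝ F ∧ ∀ u ∈ F, u ≠ 0 → 0 < b u u := by
  classical
  have hcoef : ∀ (c : ι → ℝ) (i : ι), b (∑ k, c k • f k) (f i) = c i * b (f i) (f i) := by
    intro c i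
    rw [map_sum, sum_apply, Finset.sum_eq_single i]
    · simp
    · intro k _ hki
      simp [horth k i hki]
    · simp
  have hli : LinearIndependent ℝ f := by
    rw [Fintype.linearIndependent_iff]
    intro c hc i
    have h := hcoef c i
    rw [hc] at h
    simpa [(hpos i).ne'] using h.symm
  refine ⟨Submodule.span ℝ (Set.range f), (finrank_span_eq_card hli).ge, fun u hu hu0 => ?_⟩
  obtain ⟨c, rfl⟩ := (Submodule.mem_span_range_iff_exists_fun ℝ).1 hu
  have hexp : b (∑ k, c k • f k) (∑ k, c k • f k) = ∑ i, c i ^ 2 * b (f i) (f i) := by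
    rw [map_sum (b _)]
    refine Finset.sum_congr rfl fun i _ => ?_
    rw [map_smul, hcoef, smul_eq_mul]; ring
  rw [hexp]
  obtain ⟨i, hi⟩ : ∃ i, c i ≠ 0 := by
    by_contra! h
    exact hu0 (by simp [h])
  exact Finset.sum_pos' (fun k _ => mul_nonneg (sq_nonneg _) (hpos k).le)
    ⟨i, Finset.mem_univ i, mul_pos (by positivity) (hpos i)⟩

/-- Bounded Lipschitz functions vanishing outside `Ω` belong to `X_K(Ω)`. -/
theorem exists_mem_X_of_lipschitz (hK : IsKernel K) (hΩ_open : IsOpen Ω)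
    (hΩ : Bornology.IsBounded Ω) {f : E N → ℝ} {L : NNReal} (hL : LipschitzWith L f)
    (hf1 : ∀ x, |f x| ≤ 1) (hf0 : ∀ x, x ∉ Ω → f x = 0) :
    ∃ u ∈ X K Ω, (u : E N → ℝ) =ᵐ[volume] f := by
  have hvol : volume Ω ≠ ⊤ := hΩ.measure_lt_top.ne
  have hind : Integrable (Ω.indicator (fun _ => (1 : ℝ))) (volume : Measure (E N)) :=
    (integrable_indicator_iff hΩ_open.measurableSet).2 (integrableOn_const hvol)
  have hmem : MemLp f 2 volume := by
    rw [memLp_two_iff_integrable_sq hL.continuous.aestronglyMeasurable]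
    refine hind.mono' (by have := hL.continuous; fun_prop) (Filter.Eventually.of_forall fun x => ?_)
    by_cases hx : x ∈ Ω
    · simp only [Set.indicator_of_mem hx, norm_pow, Real.norm_eq_abs]
      exact pow_le_one₀ (abs_nonneg _) (hf1 x)
    · simp [hf0 x hx, Set.indicator_of_notMem hx]
  set g : E N → ℝ := fun x => min (‖x‖ ^ 2) 1 * K x with hg
  have hgeven : ∀ x, g (-x) = g x := by
    intro x
    by_cases hx : x = 0
    · simp [hx]
    · simp only [hg, norm_neg, hK.symm x hx]
  -- A convolution integrand of two integrable functions; evenness of `K` then gives the version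
  -- with the variables exchanged.
  have hI2 : Integrable (fun p : E N × E N => Ω.indicator (fun _ => (1 : ℝ)) p.2 * g (p.1 - p.2))
      volume :=
    hind.convolution_integrand (ContinuousLinearMap.mul ℝ ℝ) hK.integrable
  have hI1 : Integrable (fun p : E N × E N => Ω.indicator (fun _ => (1 : ℝ)) p.1 * g (p.1 - p.2))
      volume := by
    refine (Integrable.swap (μ := volume) (ν := volume) hI2).congr
      (Filter.Eventually.of_forall fun p => ?_)
    simp only [Function.comp, Prod.fst_swap, Prod.snd_swap]
    rw [← hgeven (p.1 - p.2), neg_sub]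
  have hfm := hL.continuous.aestronglyMeasurable (μ := (volume : Measure (E N)))
  have hint : Integrable (fun p : E N × E N => (f p.1 - f p.2) ^ 2 * K (p.1 - p.2)) volume := by
    refine ((hI1.add hI2).const_mul ((L : ℝ) ^ 2 + 4)).mono' ?_ ?_
    · have := hL.continuous
      exact (Continuous.aestronglyMeasurable (by fun_prop)).mul hK.aestronglyMeasurable_difference
    · refine Filter.Eventually.of_forall fun p => ?_
      obtain ⟨x, y⟩ := p
      simp only [Pi.add_apply]
      by_cases hxy : x = y
      · simp [hxy, hg]
      have hKpos := hK.pos (x - y) (sub_ne_zero.2 hxy)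
      rw [Real.norm_of_nonneg (by positivity)]
      -- The Lipschitz bound serves near the diagonal and `|f x - f y| ≤ 2` away from it; `L² + 4`
      -- covers both.
      have hmain : (f x - f y) ^ 2 ≤ ((L : ℝ) ^ 2 + 4) * min (‖x - y‖ ^ 2) 1 := by
        have h1 : |f x - f y| ≤ L * ‖x - y‖ := by
          simpa [Real.dist_eq, dist_eq_norm] using hL.dist_le_mul x y
        have h2 : |f x - f y| ≤ 2 := (abs_sub _ _).trans (by linarith [hf1 x, hf1 y])
        rcases le_total (‖x - y‖ ^ 2) 1 with h | h
        · rw [min_eq_left h, ← sq_abs]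
          calc |f x - f y| ^ 2 ≤ (L * ‖x - y‖) ^ 2 := by gcongr
            _ ≤ ((L : ℝ) ^ 2 + 4) * ‖x - y‖ ^ 2 := by nlinarith [sq_nonneg ‖x - y‖]
        · rw [min_eq_right h, ← sq_abs]
          calc |f x - f y| ^ 2 ≤ 2 ^ 2 := by gcongr
            _ ≤ ((L : ℝ) ^ 2 + 4) * 1 := by nlinarith [sq_nonneg (L : ℝ)]
      have hg0 : 0 ≤ g (x - y) := by simp only [hg]; positivity
      have hfg : (f x - f y) ^ 2 * K (x - y) ≤ ((L : ℝ) ^ 2 + 4) * g (x - y) := by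
        simp only [hg]
        rw [← mul_assoc]
        gcongr
      by_cases hx : x ∈ Ω
      · have hy0 : 0 ≤ Ω.indicator (fun _ => (1 : ℝ)) y :=
          Set.indicator_nonneg (fun _ _ => zero_le_one) y
        rw [Set.indicator_of_mem hx, one_mul]
        refine hfg.trans ?_
        gcongr
        nlinarith [mul_nonneg hy0 hg0]
      · by_cases hy : y ∈ Ω
        · rw [Set.indicator_of_mem hy, Set.indicator_of_notMem hx, one_mul, zero_mul, zero_add]
          exact hfg
        · simp [hf0 x hx, hf0 y hy, Set.indicator_of_notMem hx, Set.indicator_of_notMem hy]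
  have hae := hmem.coeFn_toLp
  refine ⟨hmem.toLp f, ⟨?_, ?_⟩, hae⟩
  · rw [← hK.memLp_wdiff_iff (Lp.aestronglyMeasurable _)]
    exact ((hK.memLp_wdiff_iff hfm).2 hint).ae_eq (wdiff_congr_ae hae).symm
  · filter_upwards [hae] with x hx hxΩ
    rw [hx, hf0 x hxΩ]

/-- A set of positive measure contains any number of disjoint compact sets of positive measure. -/
theorem exists_disjoint_compacts (hN : 0 < N) {A : Set (E N)} (hA : MeasurableSet A)
    (hAb : Bornology.IsBounded A) (hA0 : volume A ≠ 0) (j : ℕ) :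
    ∃ (T : Finset (Fin N → ℤ)) (C : T → Set (E N)), j ≤ T.card ∧
      (∀ z, C z ⊆ A ∧ IsCompact (C z) ∧ volume (C z) ≠ 0) ∧
      Pairwise (Function.onFun Disjoint C) := by
  classical
  set a := volume.real A with ha
  have hAtop : volume A ≠ ⊤ := hAb.measure_lt_top.ne
  have ha0 : 0 < a := ENNReal.toReal_pos hA0 hAtop
  -- Cells have volume `h^N`, so covering `A` up to measure zero takes at least `j` of them. The cap
  -- `1` gives `h^N ≤ h`, and `j + 1` allows `j = 0`.
  obtain ⟨h, hh, hsmall⟩ : ∃ h : ℝ, 0 < h ∧ j * h ^ N ≤ a := by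
    refine ⟨min 1 (a / (j + 1)), by positivity, ?_⟩
    calc j * min 1 (a / (j + 1)) ^ N ≤ (j + 1) * min 1 (a / (j + 1)) := by
          gcongr
          · linarith
          · exact pow_le_of_le_one (by positivity) (min_le_left _ _) hN.ne'
      _ ≤ (j + 1) * (a / (j + 1)) := by gcongr; exact min_le_right _ _
      _ = a := by field_simp
  obtain ⟨S, hS⟩ := exists_gridCell_cover hAb hh
  set T := S.filter fun z => volume (A ∩ gridCell h z) ≠ 0 with hT
  have hcard : j ≤ T.card := by
    have h1 : volume A ≤ ∑ z ∈ S, volume (A ∩ gridCell h z) := by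
      refine le_trans (measure_mono ?_) (measure_biUnion_finset_le S _)
      intro x hx
      obtain ⟨z, hz, hxz⟩ := Set.mem_iUnion₂.1 (hS hx)
      exact Set.mem_iUnion₂.2 ⟨z, hz, hx, hxz⟩
    have h2 : ∑ z ∈ S, volume (A ∩ gridCell h z) = ∑ z ∈ T, volume (A ∩ gridCell h z) :=
      (Finset.sum_filter_ne_zero S).symm
    have h3 : volume A ≤ T.card * ENNReal.ofReal (h ^ N) := by
      rw [h2] at h1
      refine h1.trans ?_
      rw [← nsmul_eq_mul]
      refine Finset.sum_le_card_nsmul _ _ _ fun z _ => ?_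
      rw [← volume_gridCell hh z]
      exact measure_mono Set.inter_subset_right
    have h4 : a ≤ T.card * h ^ N := by
      have := ENNReal.toReal_mono (by finiteness) h3
      rwa [ENNReal.toReal_mul, ENNReal.toReal_natCast, ENNReal.toReal_ofReal (by positivity)]
        at this
    have h5 := le_of_mul_le_mul_right (hsmall.trans h4) (by positivity)
    exact_mod_cast h5
  have hex : ∀ z : T, ∃ C ⊆ A ∩ gridCell h z, IsCompact C ∧ 0 < volume C := fun z =>
    (hA.inter (measurableSet_gridCell h z)).exists_lt_isCompact
      (pos_iff_ne_zero.2 (Finset.mem_filter.1 z.2).2)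
  choose C hCA hCc hC0 using hex
  refine ⟨T, C, hcard, fun z => ⟨(hCA z).trans Set.inter_subset_left, hCc z, (hC0 z).ne'⟩, ?_⟩
  intro z z' hzz'
  exact (pairwise_disjoint_gridCell h (fun e => hzz' (Subtype.ext e))).mono
    ((hCA z).trans Set.inter_subset_right) ((hCA z').trans Set.inter_subset_right)

open Filter Topology in
/-- Where `ρ` is positive on a compact set, the weighted integrals of the squares of its thickened
indicators are eventually positive. -/
theorem eventually_weight_thickenedIndicator_pos (hΩ : Bornology.IsBounded Ω)
    (ρ : Lp ℝ ∞ (volume.restrict Ω)) {C : Set (E N)} (hC : IsCompact C) (hC0 : volume C ≠ 0)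
    (hCρ : ∀ x ∈ C, x ∈ Ω ∧ 0 < ρ x) {δ : ℕ → ℝ} (hδ : ∀ n, 0 < δ n)
    (hδ0 : Tendsto δ atTop (𝓝 0)) :
    ∀ᶠ n in atTop, 0 < ∫ x in Ω, ρ x * ((thickenedIndicator (hδ n) C x : ℝ) ^ 2) := by
  have : IsFiniteMeasure (volume.restrict Ω) := ⟨by simpa using hΩ.measure_lt_top⟩
  have hρi : Integrable ρ (volume.restrict Ω) := (Lp.memLp ρ).integrable le_top
  -- Dominated convergence; the limit is `∫_C ρ`, which is positive.
  have hlim : Tendsto (fun n => ∫ x in Ω, ρ x * ((thickenedIndicator (hδ n) C x : ℝ) ^ 2)) atTop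
      (𝓝 (∫ x in Ω, C.indicator ρ x)) := by
    refine tendsto_integral_of_dominated_convergence (fun x => ‖ρ x‖) (fun n => ?_) hρi.norm
      (fun n => Eventually.of_forall fun x => ?_) (Eventually.of_forall fun x => ?_)
    · refine (Lp.aestronglyMeasurable ρ).mul (Continuous.aestronglyMeasurable ?_)
      have := (thickenedIndicator (hδ n) C).continuous
      fun_prop
    · rw [norm_mul]
      refine mul_le_of_le_one_right (norm_nonneg _) ?_
      rw [Real.norm_of_nonneg (by positivity)]
      exact pow_le_one₀ (by positivity) (by exact_mod_cast thickenedIndicator_le_one (hδ n) C x)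
    · have h1 := tendsto_pi_nhds.1 (thickenedIndicator_tendsto_indicator_closure hδ hδ0 C) x
      have h2 := (((NNReal.continuous_coe.tendsto _).comp h1).pow 2).const_mul (ρ x)
      refine h2.trans_eq ?_
      rw [hC.isClosed.closure_eq]
      by_cases hx : x ∈ C <;> simp [hx]
  refine hlim.eventually_const_lt ?_
  rw [setIntegral_indicator hC.measurableSet,
    Set.inter_eq_right.2 fun x hx => (hCρ x hx).1]
  have hint : IntegrableOn ρ C := IntegrableOn.mono_set hρi fun x hx => (hCρ x hx).1
  rw [setIntegral_pos_iff_support_of_nonneg_ae ?_ hint]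
  · have hsupp : C ⊆ Function.support ρ := fun x hx => (hCρ x hx).2.ne'
    rw [Set.inter_eq_right.2 hsupp]
    exact pos_iff_ne_zero.2 hC0
  · filter_upwards [ae_restrict_mem hC.measurableSet] with x hx using (hCρ x hx).2.le

-- Disjoint compact subsets of `{ρ > 0}` have thickened indicators that, for small thickness, are
-- supported in `Ω`, pairwise disjoint (so orthogonal for the form), and of positive weighted
-- square. There are finitely many sets, so one thickness suits all.
open Filter Topology in
theorem XSpace.exists_positive_weight_subspace (hK : IsKernel K) (hΩ_open : IsOpen Ω)
    (hΩ : Bornology.IsBounded Ω) {ρ : Lp ℝ ∞ (volume.restrict Ω)} (hρ : ρ⁺ ≠ 0) (j : ℕ) :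
    ∃ F : Submodule ℝ (XSpace hK hΩ), j ≤ Module.finrank ℝ F ∧
      ∀ u ∈ F, u ≠ 0 → 0 < weightForm hK hΩ ρ u u := by
  set A := {x | x ∈ Ω ∧ 0 < ρ x} with hA
  have hAm : MeasurableSet A :=
    hΩ_open.measurableSet.inter
      (measurableSet_lt measurable_const (Lp.stronglyMeasurable ρ).measurable)
  have hA0 : volume A ≠ 0 := by
    intro h0
    refine hρ (posPart_eq_zero.2 ((Lp.coeFn_le ρ 0).1 ?_))
    have h1 : ∀ᵐ x ∂volume.restrict Ω, x ∉ A :=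
      ae_restrict_of_ae (measure_eq_zero_iff_ae_notMem.1 h0)
    filter_upwards [h1, ae_restrict_mem hΩ_open.measurableSet,
      Lp.coeFn_zero ℝ ∞ (volume.restrict Ω)] with x hx hxΩ h0
    rw [h0]
    exact not_lt.1 fun h => hx ⟨hxΩ, h⟩
  obtain ⟨T, C, hT, hC, hCd⟩ := exists_disjoint_compacts hK.dim_pos hAm
    (hΩ.subset fun x hx => hx.1) hA0 j
  set δ : ℕ → ℝ := fun n => 1 / ((n : ℝ) + 1) with hδdef
  have hδ : ∀ n, 0 < δ n := fun n => Nat.one_div_pos_of_nat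
  have hδ0 : Tendsto δ atTop (𝓝 0) := tendsto_one_div_add_atTop_nhds_zero_nat
  have hsub : ∀ᶠ n in atTop, ∀ z, Metric.thickening (δ n) (C z) ⊆ Ω := by
    rw [eventually_all]
    intro z
    obtain ⟨ε, hε, h⟩ := (hC z).2.1.exists_thickening_subset_open hΩ_open
      fun x hx => ((hC z).1 hx).1
    filter_upwards [hδ0.eventually_lt_const hε] with n hn
    exact (Metric.thickening_mono hn.le _).trans h
  have hdisj : ∀ᶠ n in atTop, ∀ z z', z ≠ z' →
      Disjoint (Metric.thickening (δ n) (C z)) (Metric.thickening (δ n) (C z')) := by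
    simp_rw [eventually_all]
    intro z z' hzz'
    obtain ⟨ε, hε, h⟩ := (hCd hzz').exists_thickenings (hC z).2.1 (hC z').2.1.isClosed
    filter_upwards [hδ0.eventually_lt_const hε] with n hn
    exact h.mono (Metric.thickening_mono hn.le _) (Metric.thickening_mono hn.le _)
  have hpos : ∀ᶠ n in atTop, ∀ z,
      0 < ∫ x in Ω, ρ x * ((thickenedIndicator (hδ n) (C z) x : ℝ) ^ 2) := by
    rw [eventually_all]
    intro z
    exact eventually_weight_thickenedIndicator_pos hΩ ρ (hC z).2.1 (hC z).2.2
      (fun x hx => (hC z).1 hx) hδ hδ0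
  obtain ⟨n, hn1, hn2, hn3⟩ := (hsub.and (hdisj.and hpos)).exists
  set f : T → E N → ℝ := fun z x => thickenedIndicator (hδ n) (C z) x with hf
  have hf0 : ∀ z x, x ∉ Metric.thickening (δ n) (C z) → f z x = 0 := by
    intro z x hx
    simp only [hf]
    rw [thickenedIndicator_zero (hδ n) (C z) hx, NNReal.coe_zero]
  have hex : ∀ z, ∃ u : XSpace hK hΩ, val hK hΩ u =ᵐ[volume] f z := by
    intro z
    obtain ⟨u, hu, hae⟩ := exists_mem_X_of_lipschitz hK hΩ_open hΩ (f := f z)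
      (L := (δ n).toNNReal⁻¹)
      (lipschitzWith_thickenedIndicator (hδ n) (C z))
      (fun x => by
        rw [abs_of_nonneg (by positivity)]
        exact_mod_cast thickenedIndicator_le_one (hδ n) (C z) x)
      (fun x hx => hf0 z x fun h => hx (hn1 z h))
    obtain ⟨v, rfl⟩ := exists_val_eq (hK := hK) (hΩ := hΩ) hu
    exact ⟨v, hae⟩
  choose u hu using hex
  have hform : ∀ z z', weightForm hK hΩ ρ (u z) (u z') = ∫ x in Ω, ρ x * (f z x * f z' x) := by
    intro z z'
    rw [weightForm_apply]
    refine integral_congr_ae (ae_restrict_of_ae ?_)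
    filter_upwards [hu z, hu z'] with x h1 h2
    rw [h1, h2]
  have horth : ∀ z z', z ≠ z' → weightForm hK hΩ ρ (u z) (u z') = 0 := by
    intro z z' hzz'
    rw [hform]
    have h0 : ∀ x, f z x * f z' x = 0 := by
      intro x
      by_cases hx : x ∈ Metric.thickening (δ n) (C z)
      · rw [hf0 z' x (Set.disjoint_left.1 (hn2 z z' hzz') hx), mul_zero]
      · rw [hf0 z x hx, zero_mul]
    simp [h0]
  have hdiag : ∀ z, 0 < weightForm hK hΩ ρ (u z) (u z) := by
    intro z
    rw [hform]
    simpa only [hf, sq] using hn3 z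
  obtain ⟨F, hF, hFpos⟩ := exists_positive_subspace (weightForm hK hΩ ρ) u horth hdiag
  exact ⟨F, hT.trans (by simpa using hF), hFpos⟩

/-! ### From abstract minimax values to the eigenvalues. -/

theorem XSpace.minimaxValue_weightForm_lt (hK : IsKernel K) (hΩ_open : IsOpen Ω)
    (hΩ : Bornology.IsBounded Ω) {ρ ρ' : Lp ℝ ∞ (volume.restrict Ω)} (hle : ρ ≤ ρ') (hne : ρ ≠ ρ')
    (hucp : UCP K Ω ρ ∨ UCP K Ω ρ') (hρ : ρ⁺ ≠ 0) {j : ℕ} (hj : 0 < j) :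
    0 < minimaxValue (weightForm hK hΩ ρ) j ∧
      minimaxValue (weightForm hK hΩ ρ) j < minimaxValue (weightForm hK hΩ ρ') j := by
  obtain ⟨c, hc0, hc⟩ := exists_ae_abs_le ρ
  obtain ⟨c', hc0', hc'⟩ := exists_ae_abs_le ρ'
  have hb := weightForm_self_le hK hΩ ρ (le_max_of_le_left hc0 : 0 ≤ max c c')
    (hc.mono fun x hx => le_max_of_le_left hx)
  have hb' := weightForm_self_le hK hΩ ρ' (le_max_of_le_left hc0 : 0 ≤ max c c')
    (hc'.mono fun x hx => le_max_of_le_right hx)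
  have hpos := exists_positive_weight_subspace hK hΩ_open hΩ hρ j
  refine ⟨minimaxValue_pos _ (weightForm_symm hK hΩ ρ) _ (isCompactOperator_incl hK hΩ) _
    (le_max_of_le_left hc0) hb hj hpos, ?_⟩
  refine minimaxValue_lt _ _ (weightForm_symm hK hΩ ρ) (weightForm_symm hK hΩ ρ') _
    (isCompactOperator_incl hK hΩ) _ (le_max_of_le_left hc0) hb hb' hj hpos
    (weightForm_mono hK hΩ hle) ?_
  refine hucp.imp ?_ ?_ <;>
  · intro h m u hm hu0 hu
    exact weightForm_lt hK hΩ hΩ_open.measurableSet hle hne u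
      (h _ _ (isEigenfunction_of_isFormEigen hK hΩ hm hu0 hu))

namespace XSpace

variable (hK : IsKernel K) (hΩ : Bornology.IsBounded Ω)

/-- The subspace of `L²` underlying a subspace of `XSpace`. -/
noncomputable def toSubspaces {j : ℕ}
    (F : {F : Submodule ℝ (XSpace hK hΩ) // Module.finrank ℝ F = j}) : Subspaces K Ω j :=
  ⟨F.1.map (val hK hΩ), by
    rintro _ ⟨u, -, rfl⟩
    exact val_mem u, by
    exact (Submodule.equivMapOfInjective _ val_injective F.1).finrank_eq.symm.trans F.2⟩

theorem toSubspaces_surjective {j : ℕ} :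
    Function.Surjective (toSubspaces hK hΩ (j := j)) := by
  rintro ⟨F, hF, hFj⟩
  have hmap : (F.comap (val hK hΩ)).map (val hK hΩ) = F := by
    refine Submodule.map_comap_eq_of_le fun u hu => ?_
    obtain ⟨v, rfl⟩ := exists_val_eq (hK := hK) (hΩ := hΩ) (hF hu)
    exact ⟨v, rfl⟩
  refine ⟨⟨F.comap (val hK hΩ), ?_⟩, Subtype.ext hmap⟩
  rw [← hFj, ← congrArg (fun G : Submodule ℝ (Lp ℝ 2 volume) => Module.finrank ℝ G) hmap]
  exact (Submodule.equivMapOfInjective _ val_injective _).finrank_eq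

/-- The unit sphere of a subspace, mapped to `L²`. -/
noncomputable def toSphere {j : ℕ}
    (F : {F : Submodule ℝ (XSpace hK hΩ) // Module.finrank ℝ F = j})
    (u : {u : XSpace hK hΩ // u ∈ F.1 ∧ ‖u‖ = 1}) : sphere K (toSubspaces hK hΩ F).1 :=
  ⟨val hK hΩ u.1, ⟨u.1, u.2.1, rfl⟩, by rw [← norm_sq_eq_form, u.2.2, one_pow]⟩

theorem toSphere_surjective {j : ℕ}
    (F : {F : Submodule ℝ (XSpace hK hΩ) // Module.finrank ℝ F = j}) :
    Function.Surjective (toSphere hK hΩ F) := by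
  rintro ⟨_, ⟨u, hu, rfl⟩, hu1⟩
  refine ⟨⟨u, hu, ?_⟩, rfl⟩
  rw [← norm_sq_eq_form] at hu1
  exact (pow_eq_one_iff_of_nonneg (norm_nonneg _) two_ne_zero).1 hu1

theorem eigenvalue_of_pos (ρ : Lp ℝ ∞ (volume.restrict Ω)) {k : ℤ} (hk : 0 < k) :
    eigenvalue K Ω ρ k = (minimaxValue (weightForm hK hΩ ρ) k.natAbs)⁻¹ := by
  rw [eigenvalue, if_pos hk, minimaxValue]
  congr 1
  refine ((toSubspaces_surjective hK hΩ).iSup_congr _ fun F => ?_).symm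
  refine ((toSphere_surjective hK hΩ F).iInf_congr _ fun u => ?_).symm
  rw [weightForm_self]
  rfl

/-- No boundedness is needed: the default values of real suprema and infima are compatible with
negation. -/
theorem real_iSup_neg {ι : Sort*} (f : ι → ℝ) : ⨆ i, -f i = -⨅ i, f i := by
  rw [iSup, iInf, ← Real.sSup_neg]
  congr 1
  ext x
  simp [neg_eq_iff_eq_neg]

theorem real_iInf_neg {ι : Sort*} (f : ι → ℝ) : ⨅ i, -f i = -⨆ i, f i := by
  rw [iSup, iInf, ← Real.sInf_neg]
  congr 1
  ext x
  simp [neg_eq_iff_eq_neg]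

theorem eigenvalue_of_neg (ρ : Lp ℝ ∞ (volume.restrict Ω)) {k : ℤ} (hk : k < 0) :
    eigenvalue K Ω ρ k = -(minimaxValue (weightForm hK hΩ (-ρ)) k.natAbs)⁻¹ := by
  rw [eigenvalue, if_neg hk.le.not_gt, minimaxValue]
  simp_rw [weightForm_neg, real_iInf_neg, real_iSup_neg]
  rw [inv_neg, neg_neg]
  congr 1
  refine ((toSubspaces_surjective hK hΩ).iInf_congr _ fun F => ?_).symm
  refine ((toSphere_surjective hK hΩ F).iSup_congr _ fun u => ?_).symm
  rw [weightForm_self]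
  rfl

end XSpace

/-- The eigenfunctions of `ρ` and `-ρ` coincide, with eigenvalues of opposite sign; the property
quantifies over all real eigenvalues. -/
theorem UCP.neg {ρ : Lp ℝ ∞ (volume.restrict Ω)} (h : UCP K Ω ρ) : UCP K Ω (-ρ) := by
  rintro lam u ⟨hu, hu0, heq⟩
  refine h (-lam) u ⟨hu, hu0, fun v hv => ?_⟩
  rw [heq v hv, neg_mul, ← mul_neg, ← integral_neg]
  congr 1
  refine integral_congr_ae ?_
  filter_upwards [Lp.coeFn_neg ρ] with x hx
  rw [hx, Pi.neg_apply, neg_mul]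

end NonlocalEigen

theorem theorem3p2 {N : ℕ} (K : NonlocalEigen.E N → ℝ) (hK : NonlocalEigen.IsKernel K)
    (Ω : Set (NonlocalEigen.E N)) (hΩ_open : IsOpen Ω) (hΩ_bdd : Bornology.IsBounded Ω)
    (ρ ρ' : Lp ℝ ∞ (volume.restrict Ω)) (hρ : ρ ≠ 0) (hρ' : ρ' ≠ 0)
    (hle : ρ ≤ ρ') (hne : ρ ≠ ρ')
    (hucp : NonlocalEigen.UCP K Ω ρ ∨ NonlocalEigen.UCP K Ω ρ')
    (k : ℤ) (hk : NonlocalEigen.Admissible ρ k) (hk' : NonlocalEigen.Admissible ρ' k) :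
    NonlocalEigen.eigenvalue K Ω ρ k > NonlocalEigen.eigenvalue K Ω ρ' k := by
  rcases hk with ⟨hk0, hpos⟩ | ⟨hk0, -⟩
  · obtain ⟨h0, hlt⟩ := NonlocalEigen.XSpace.minimaxValue_weightForm_lt hK hΩ_open hΩ_bdd hle hne
      hucp hpos (Int.natAbs_pos.2 hk0.ne')
    rw [NonlocalEigen.XSpace.eigenvalue_of_pos hK hΩ_bdd ρ hk0,
      NonlocalEigen.XSpace.eigenvalue_of_pos hK hΩ_bdd ρ' hk0]
    exact inv_strictAnti₀ h0 hlt
  · have hneg : ρ'⁻ ≠ 0 := by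
      rcases hk' with ⟨h, -⟩ | ⟨-, h⟩
      · exact absurd h hk0.not_gt
      · exact h
    -- Negation reverses the order, so `-ρ'` is now the smaller weight, and only the smaller one
    -- must have a nonzero positive part: `(-ρ')⁺ = ρ'⁻`.
    obtain ⟨h0, hlt⟩ := NonlocalEigen.XSpace.minimaxValue_weightForm_lt hK hΩ_open hΩ_bdd
      (neg_le_neg hle) (fun h => hne (neg_injective h).symm)
      (hucp.symm.imp NonlocalEigen.UCP.neg NonlocalEigen.UCP.neg)
      (by rwa [posPart_neg]) (Int.natAbs_pos.2 hk0.ne)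
    rw [NonlocalEigen.XSpace.eigenvalue_of_neg hK hΩ_bdd ρ hk0,
      NonlocalEigen.XSpace.eigenvalue_of_neg hK hΩ_bdd ρ' hk0]
    exact neg_lt_neg (inv_strictAnti₀ h0 hlt)
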